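/- Let $k$ be a field, $n\ge 0$, $R=k[x_1,\dots,x_n]$, let $<$ be a monomial order on $R$, and let $S=k[f_1,\dots,f_m]\subseteq R$ be a subalgebra generated by finitely many homogeneous polynomials (of possibly different degrees). Let $\mathrm{in}_<(S)=k[\mathrm{in}_<(g)\mid g\in S]\subseteq R$ be its initial algebra, where $\mathrm{in}_<(g)$ is the initial term of $g$ with respect to $<$; it need not be Noetherian. Grade $S$ and $\mathrm{in}_<(S)$ by total degree. For an $\mathbb N$-graded $k$-algebra $A=\bigoplus_{i\ge0}A_i$ with $A_0=k$ and all $\dim_k A_i$ finite, let $P_A(t)=\sum_{i\ge 0}(\dim_k A_i)\,t^i$. Call $A$ a Hilbert–Serre ring if $P_A$ has radius of convergence at least $1$ and, for some $e\in\mathbb N$, $(1-t)^eP_A(t)$ has a finite limit as $t\to1^-$; the least such $e$ is the Hilbert–Serre dimension $d(A)$. For a $k$-algebra $A$, let $$\mathrm{GKdim}_k(A)=\sup_V\limsup_{N\to\infty}\frac{\log\dim_k(k+V+\cdots+V^N)}{\log N},$$ where $V$ runs over the finite-dimensional $k$-subspaces of $A$. Let $\dim$ denote Krull dimension and $\mathrm{trdeg}_k$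 transcendence degree over $k$. Then $S$ and $\mathrm{in}_<(S)$ are Hilbert–Serre rings, and all their dimensions are finite and coincide: $$\dim(S)=\mathrm{trdeg}_k(S)=\mathrm{GKdim}_k(S)=d(S)=\dim(\mathrm{in}_<(S))=\mathrm{trdeg}_k(\mathrm{in}_<(S))=\mathrm{GKdim}_k(\mathrm{in}_<(S))=d(\mathrm{in}_<(S)).$$ -/

import Mathlib

open Filter Topology

noncomputable section

/-- The Gelfand-Kirillov dimension of a `k`-algebra `A`: the supremum over all finite-dimensional
subspaces `V` of `limsup log (d_V(n)) / log n`, where `d_V(n) = dim_k (k + V + ⋯ + V ^ n)`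
(in `Submodule k A`, `V ^ 0 = 1` is the image of `k`). The value is an extended real. -/
def gkDim (k A : Type*) [Field k] [CommRing A] [Algebra k A] : EReal :=
  ⨆ V : {V : Submodule k A // FiniteDimensional k V},
    limsup (fun n : ℕ =>
      ((Real.log (Module.finrank k (⨆ i ∈ Finset.range (n + 1), V.1 ^ i : Submodule k A))
        / Real.log n : ℝ) : EReal)) atTop

section Graded

variable {k A : Type*} [Field k] [CommRing A] [Algebra k A] (𝒜 : ℕ → Submodule k A)

/-- The value at the real number `t` of the Poincaré series `∑ (dim_k A_n) t ^ n`. -/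
def poincareSeries (t : ℝ) : ℝ := ∑' n : ℕ, (Module.finrank k (𝒜 n) : ℝ) * t ^ n

/-- The radius of convergence of the Poincaré series `∑ (dim_k A_n) t ^ n`. -/
def poincareRadius : ENNReal :=
  (FormalMultilinearSeries.ofScalars ℝ (fun n : ℕ => (Module.finrank k (𝒜 n) : ℝ))).radius

/-- The exponents `d` for which `(1 - t) ^ d * P(t)` has a finite limit as `t` tends to `1` from
the left. -/
def poleExponents : Set ℕ :=
  {d : ℕ | ∃ L : ℝ, Tendsto (fun t : ℝ => (1 - t) ^ d * poincareSeries 𝒜 t) (𝓝[<] 1) (𝓝 L)}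

/-- `A = ⨁ 𝒜 n` is an `ℕ`-graded ring with `A_0 = k` which is a Hilbert-Serre ring.

The radius of convergence is required to be at least `1`. As the coefficients are natural numbers,
it is then exactly `1` unless `A` is finite-dimensional over `k` (for instance `A = k`), in which
case the Poincaré series is a polynomial. -/
structure IsHilbertSerre : Prop where
  gradedMonoid : SetLike.GradedMonoid 𝒜
  isInternal : DirectSum.IsInternal 𝒜
  injective_algebraMap : Function.Injective (algebraMap k A)
  zero_eq : 𝒜 0 = 1
  finiteDimensional : ∀ n, FiniteDimensional k (𝒜 n)
  one_le_radius : 1 ≤ poincareRadius 𝒜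
  nonempty_poleExponents : (poleExponents 𝒜).Nonempty

/-- The Hilbert-Serre dimension: the least `d` for which `(1 - t) ^ d * P(t)` has a finite limit
as `t` tends to `1` from the left. -/
def hilbertSerreDim : ℕ := sInf (poleExponents 𝒜)

end Graded

section Initial

variable {k : Type*} [Field k] {n : ℕ}

/-- The grading of a subalgebra `B` of `k[x_1, …, x_n]` by total degree: the degree `i` piece
consists of the elements of `B` that are homogeneous polynomials of degree `i`. -/
def degreePiece (B : Subalgebra k (MvPolynomial (Fin n) k)) (i : ℕ) : Submodule k B :=
  (MvPolynomial.homogeneousSubmodule (Fin n) k i).comap B.val.toLinearMap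

/-- The initial algebra of `B`: the subalgebra generated by the initial terms of all elements of
`B` (the initial term of `0` being `0`). -/
def initialAlgebra (m : MonomialOrder (Fin n)) (B : Subalgebra k (MvPolynomial (Fin n) k)) :
    Subalgebra k (MvPolynomial (Fin n) k) :=
  Algebra.adjoin k (m.leadingTerm '' (B : Set (MvPolynomial (Fin n) k)))

/-- `B` is generated, as a `k`-algebra, by finitely many homogeneous polynomials (of possibly
different degrees). -/
def IsFGHomogeneous (B : Subalgebra k (MvPolynomial (Fin n) k)) : Prop :=
  ∃ F : Finset (MvPolynomial (Fin n) k),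
    (∀ f ∈ F, ∃ e : ℕ, f.IsHomogeneous e) ∧ B = Algebra.adjoin k (F : Set (MvPolynomial (Fin n) k))

end Initial

end

noncomputable section

/-! Everything is measured against the transcendence degree `s`. For any subalgebra `A` of the
polynomial ring, finitely generated or not, `dim A_{≤N}` lies between positive constant multiples of
`(N+1)^s` (`finrank_totalDegreeLE_le`, `exists_le_finrank_totalDegreeLE`). This gives the GK
dimension, and for graded `A` it bounds `(1-t)^s P_A(t)` above and away from zero.

That the limit exists needs more. The standard monomials in the generators of `S` form a basis
indexed by a lower set of `ℕ^m`, and by Dickson's lemma the generating function of a lower set has a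
genuine pole at `1` (`hasPositivePole_tsum_indicator`). The growth bounds force its order to be `s`.

Passing to initial terms preserves the Hilbert function (`poincareSeries_initialAlgebra`), so both
algebras have the same `d`, hence the same transcendence degree.

The Krull dimension of `S` comes from Noether normalization. The initial algebra becomes finitely
generated once a single monomial is inverted, because its exponents generate a finitely generated
group; this yields enough primes (`ringKrullDim_eq_of_trdeg_eq`). -/

/-! ### Krull dimension and transcendence degree -/

theorem ringKrullDim_eq_of_isIntegral_of_injective {R S : Type*} [CommRing R] [CommRing S]
    [Algebra R S] [Algebra.IsIntegral R S] [FaithfulSMul R S] :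
    ringKrullDim S = ringKrullDim R := by
  apply le_antisymm
  · exact Order.krullDim_le_of_strictMono (PrimeSpectrum.comap (algebraMap R S))
      fun P Q h ↦ Ideal.IsIntegral.comap_lt_comap (R := R) (I := P.asIdeal) (J := Q.asIdeal) h
  · refine iSup_le fun l ↦ ?_
    -- Lying over lifts the bottom of the chain; going up then lifts the rest.
    obtain ⟨P, hP, hlo⟩ := Ideal.exists_ideal_over_prime_of_isIntegral l.head.asIdeal
      (⊥ : Ideal S) (by
        rw [Ideal.comap_bot_of_injective _ (FaithfulSMul.algebraMap_injective R S)]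
        exact bot_le)
    have : P.LiesOver l.head.asIdeal := ⟨hlo.2.symm⟩
    have := hlo.1
    obtain ⟨M, hM, -, -⟩ := Ideal.exists_ltSeries_of_hasGoingUp l P
    rw [← hM]
    exact Order.LTSeries.length_le_krullDim M

/-- The dimension of an affine domain is its transcendence degree. -/
theorem exists_trdeg_eq_ringKrullDim_of_finiteType (k B : Type*) [Field k] [CommRing B]
    [IsDomain B] [Algebra k B] [Algebra.FiniteType k B] :
    ∃ d : ℕ, Algebra.trdeg k B = d ∧ ringKrullDim B = d := by
  -- Noether normalization: an injective integral extension changes neither invariant, so both equal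
  -- the number of variables.
  obtain ⟨s, g, hinj, hint⟩ := exists_integral_inj_algHom_of_fg k B
  algebraize [g.toRingHom]
  have : Algebra.IsIntegral (MvPolynomial (Fin s) k) B := ⟨hint⟩
  have : FaithfulSMul (MvPolynomial (Fin s) k) B :=
    (faithfulSMul_iff_algebraMap_injective _ _).mpr hinj
  have : IsScalarTower k (MvPolynomial (Fin s) k) B :=
    IsScalarTower.of_algebraMap_eq fun x ↦ (g.commutes x).symm
  refine ⟨s, ?_, ?_⟩
  · have h := lift_trdeg_add_eq k (MvPolynomial (Fin s) k) B
    rw [MvPolynomial.trdeg_of_isDomain, trdeg_eq_zero (R := MvPolynomial (Fin s) k)] at h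
    simpa using h.symm
  · rw [ringKrullDim_eq_of_isIntegral_of_injective (R := MvPolynomial (Fin s) k),
      MvPolynomial.ringKrullDim_of_isNoetherianRing, ringKrullDim_eq_zero_of_field]
    simp

/-- A chain of primes stays strict after contraction to the subalgebra generated by one separating
element per step. That subalgebra is an affine domain of no larger transcendence degree. -/
theorem ringKrullDim_le_of_trdeg_eq {k A : Type*} [Field k] [CommRing A] [IsDomain A]
    [Algebra k A] {d : ℕ} (hd : Algebra.trdeg k A = d) : ringKrullDim A ≤ d := by
  refine iSup_le fun l ↦ ?_
  have hx (i : Fin l.length) : ∃ x : A, x ∈ (l i.succ).asIdeal ∧ x ∉ (l i.castSucc).asIdeal := by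
    obtain ⟨-, x, hx⟩ := SetLike.lt_iff_le_and_exists.mp (show (l i.castSucc).asIdeal < (l i.succ).asIdeal from l.strictMono i.castSucc_lt_succ)
    exact ⟨x, hx⟩
  choose x hx using hx
  set B := Algebra.adjoin k (Set.range x)
  have : Algebra.FiniteType k B :=
    (Subalgebra.fg_iff_finiteType _).mp (Subalgebra.fg_def.mpr ⟨_, Set.finite_range x, rfl⟩)
  obtain ⟨e, he, hB⟩ := exists_trdeg_eq_ringKrullDim_of_finiteType k B
  have hed : (e : WithBot ℕ∞) ≤ d := by
    have := trdeg_le_of_injective B.val Subtype.val_injective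
    rw [he, hd] at this
    exact_mod_cast this
  refine le_trans ?_ (hB.le.trans hed)
  let M : LTSeries (PrimeSpectrum B) :=
    { length := l.length
      toFun := fun i ↦ PrimeSpectrum.comap (algebraMap B A) (l i)
      step := fun i ↦ by
        refine SetLike.lt_iff_le_and_exists.mpr
          ⟨Ideal.comap_mono (show (l i.castSucc).asIdeal < _ from l.strictMono i.castSucc_lt_succ).le,
            ⟨x i, Algebra.subset_adjoin ⟨i, rfl⟩⟩, (hx i).1, (hx i).2⟩ }
  exact Order.LTSeries.length_le_krullDim M

/-- If `A` becomes finitely generated after inverting one nonzero element, then the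
dimension of `A` is its transcendence degree. -/
theorem ringKrullDim_eq_of_trdeg_eq {k A : Type*} [Field k] [CommRing A] [IsDomain A]
    [Algebra k A] {d : ℕ} (hd : Algebra.trdeg k A = d) (B : Subalgebra k A) (hB : B.FG) (f : A)
    (hf : f ≠ 0) (h : ∀ a : A, ∃ M : ℕ, a * f ^ M ∈ B) :
    ringKrullDim A = d := by
  apply le_antisymm (ringKrullDim_le_of_trdeg_eq hd)
  have hle : Submonoid.powers f ≤ nonZeroDivisors A := powers_le_nonZeroDivisors_of_noZeroDivisors hf
  -- `C` is generated by `1/f` and the generators of `B`, so it is an affine domain. It is algebraic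
  -- over `A`, hence has dimension `d`, and its primes embed in those of `A`.
  let C := Localization.Away f
  have : IsDomain C := IsLocalization.isDomain_localization hle
  have : FaithfulSMul A C :=
    (faithfulSMul_iff_algebraMap_injective _ _).mpr (IsLocalization.injective C hle)
  have : Algebra.IsAlgebraic A C := IsLocalization.isAlgebraic C (Submonoid.powers f)
  have : Algebra.FiniteType k C := by
    refine ⟨?_⟩
    obtain ⟨s, hs⟩ := hB
    set u : C := IsLocalization.Away.invSelf f
    have hu : algebraMap A C f * u = 1 := IsLocalization.Away.mul_invSelf f
    set D : Subalgebra k C := Algebra.adjoin k (insert u (algebraMap A C '' s))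
    have hBD : ∀ b ∈ B, algebraMap A C b ∈ D := by
      intro b hb
      rw [← hs] at hb
      have hm : IsScalarTower.toAlgHom k A C b ∈
          (Algebra.adjoin k (s : Set A)).map (IsScalarTower.toAlgHom k A C) := ⟨b, hb, rfl⟩
      rw [AlgHom.map_adjoin] at hm
      exact Algebra.adjoin_mono (Set.subset_insert _ _) hm
    have huD : u ∈ D := Algebra.subset_adjoin (Set.mem_insert _ _)
    have hD : D = ⊤ := by
      refine eq_top_iff.mpr fun c _ ↦ ?_
      obtain ⟨m, a, ha⟩ := IsLocalization.Away.surj f c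
      obtain ⟨M, hM⟩ := h a
      have : c = algebraMap A C (a * f ^ M) * u ^ (m + M) := by
        rw [map_mul, ← ha, map_pow, mul_assoc, mul_assoc, ← mul_assoc, mul_assoc,
          ← mul_assoc (algebraMap A C f ^ m), ← pow_add, ← mul_pow, hu, one_pow, mul_one]
      rw [this]
      exact mul_mem (hBD _ hM) (pow_mem huD _)
    rw [← hD]
    exact Subalgebra.fg_def.mpr ⟨_, (s.finite_toSet.image _).insert _, rfl⟩
  obtain ⟨e, he, hC⟩ := exists_trdeg_eq_ringKrullDim_of_finiteType k C
  have h := trdeg_add_eq k A (A := C)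
  rw [trdeg_eq_zero (R := A), add_zero, hd, he] at h
  rw [Nat.cast_injective h, ← hC]
  refine Order.krullDim_le_of_strictMono (PrimeSpectrum.comap (algebraMap A C)) ?_
  exact Monotone.strictMono_of_injective (fun P Q h ↦ Ideal.comap_mono h)
    (PrimeSpectrum.localization_comap_injective C (Submonoid.powers f))

/-! ### Growth of subalgebras of a polynomial ring -/

theorem AlgebraicIndependent.linearIndependent_prod_pow {ι R A : Type*} [Fintype ι] [CommRing R]
    [CommRing A] [Algebra R A] {y : ι → A} (hy : AlgebraicIndependent R y) (M : ℕ) :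
    LinearIndependent R (fun α : ι → Fin (M + 1) ↦ ∏ i, y i ^ (α i : ℕ)) := by
  have h := ((MvPolynomial.basisMonomials ι R).linearIndependent.map'
    (MvPolynomial.aeval y).toLinearMap (LinearMap.ker_eq_bot.mpr hy)).comp
    (fun α : ι → Fin (M + 1) ↦ Finsupp.equivFunOnFinite.symm (fun i ↦ (α i : ℕ))) (by
      intro α β hαβ
      funext i
      exact Fin.ext (DFunLike.congr_fun hαβ i))
  have heq : (fun α : ι → Fin (M + 1) ↦ ∏ i, y i ^ (α i : ℕ)) =
      ((MvPolynomial.aeval y).toLinearMap ∘ MvPolynomial.basisMonomials ι R) ∘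
        fun α : ι → Fin (M + 1) ↦ Finsupp.equivFunOnFinite.symm (fun i ↦ (α i : ℕ)) := by
    funext α
    simp [MvPolynomial.aeval_monomial, Finsupp.prod_fintype]
  rw [heq]
  exact h

theorem exists_algebraicIndependent_of_trdeg_eq {k A : Type*} [Field k] [CommRing A] [IsDomain A]
    [Algebra k A] {s : ℕ} (hs : Algebra.trdeg k A = s) :
    ∃ y : Fin s → A, AlgebraicIndependent k y := by
  obtain ⟨ι, x, hx⟩ := exists_isTranscendenceBasis' k A
  have hι : Cardinal.mk ι = s := hx.cardinalMk_eq_trdeg.trans hs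
  have e : Fin s ≃ ι := by
    refine Classical.choice (Cardinal.lift_mk_eq'.mp ?_)
    simp [hι]
  exact ⟨x ∘ e, hx.1.comp e e.injective⟩

theorem MvPolynomial.finrank_restrictTotalDegree_le (k : Type*) [Field k] (n N : ℕ) :
    Module.finrank k (restrictTotalDegree (Fin n) k N) ≤ (N + 1) ^ n := by
  refine (Submodule.finrank_mono (restrictTotalDegree_le_restrictDegree (Fin n) (R := k) N)).trans ?_
  let b := basisRestrictSupport k {a : Fin n →₀ ℕ | ∀ i, a i ≤ N}
  let φ : {a : Fin n →₀ ℕ | ∀ i, a i ≤ N} → (Fin n → Fin (N + 1)) :=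
    fun a i ↦ ⟨a.1 i, Nat.lt_succ_of_le (a.2 i)⟩
  have hφ : Function.Injective φ := fun a b h ↦
    Subtype.ext (Finsupp.ext fun i ↦ congrArg Fin.val (congrFun h i))
  rw [restrictDegree, Module.finrank_eq_nat_card_basis b]
  simpa using Nat.card_le_card_of_injective φ hφ

section Growth

variable {k : Type*} [Field k] {n : ℕ}

/-- The elements of total degree at most `N` of a subalgebra of a polynomial ring. -/
def totalDegreeLE (A : Subalgebra k (MvPolynomial (Fin n) k)) (N : ℕ) :
    Submodule k (MvPolynomial (Fin n) k) :=
  A.toSubmodule ⊓ MvPolynomial.restrictTotalDegree (Fin n) k N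

theorem mem_totalDegreeLE {A : Subalgebra k (MvPolynomial (Fin n) k)} {N : ℕ}
    {p : MvPolynomial (Fin n) k} : p ∈ totalDegreeLE A N ↔ p ∈ A ∧ p.totalDegree ≤ N := by
  simp [totalDegreeLE, MvPolynomial.mem_restrictTotalDegree]

instance (A : Subalgebra k (MvPolynomial (Fin n) k)) (N : ℕ) :
    FiniteDimensional k (totalDegreeLE A N) :=
  Submodule.finiteDimensional_inf_right _ _

variable (A : Subalgebra k (MvPolynomial (Fin n) k))

theorem exists_trdeg_eq : ∃ s : ℕ, Algebra.trdeg k A = s := by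
  refine Cardinal.lt_aleph0.mp ((trdeg_le_of_injective A.val Subtype.val_injective).trans_lt ?_)
  exact trdeg_lt_aleph0_of_finiteType

theorem adjoin_range_X_eq_top :
    Algebra.adjoin A (Set.range (MvPolynomial.X : Fin n → MvPolynomial (Fin n) k)) = ⊤ := by
  refine eq_top_iff.mpr fun p _ ↦ ?_
  induction p using MvPolynomial.induction_on with
  | C a => exact Subalgebra.algebraMap_mem _ (algebraMap k A a)
  | add p q hp hq => exact add_mem (hp trivial) (hq trivial)
  | mul_X p i hp => exact mul_mem (hp trivial) (Algebra.subset_adjoin ⟨i, rfl⟩)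

/-- Some `r = n - s` of the variables form a transcendence basis of `R` over `A`. Multiplying a
basis of `A_{≤N}` by their monomials with exponents at most `N` gives independent elements of degree
at most `N + rN`. Comparing with the count for `R` and cancelling `(N+1)^r` leaves the exponent `s`.
-/
theorem finrank_totalDegreeLE_le {s : ℕ} (hs : Algebra.trdeg k A = s) (N : ℕ) :
    Module.finrank k (totalDegreeLE A N) ≤ (n + 1) ^ n * (N + 1) ^ s := by
  classical
  let R := MvPolynomial (Fin n) k
  have : Algebra.IsAlgebraic (Algebra.adjoin A (Set.range (MvPolynomial.X : Fin n → R))) R :=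
    ⟨fun p ↦ isAlgebraic_algebraMap (R := Algebra.adjoin A
      (Set.range (MvPolynomial.X : Fin n → R))) ⟨p, by rw [adjoin_range_X_eq_top]; trivial⟩⟩
  obtain ⟨t, htX, ht⟩ := exists_isTranscendenceBasis_subset (R := A)
    (Set.range (MvPolynomial.X : Fin n → R))
  have : Fintype t := ((Set.finite_range _).subset htX).fintype
  have hcard : s + Fintype.card t = n := by
    have h := trdeg_add_eq k A (A := R)
    rw [← ht.cardinalMk_eq_trdeg, hs, MvPolynomial.trdeg_of_isDomain] at h
    simp only [Cardinal.mk_fintype, Cardinal.lift_natCast, Fintype.card_fin] at h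
    exact_mod_cast h
  set r := Fintype.card t
  have hle : totalDegreeLE A N ≤ A.toSubmodule := inf_le_left
  let b : Fin (Module.finrank k (totalDegreeLE A N)) → A :=
    fun i ↦ Submodule.inclusion hle (Module.finBasis k (totalDegreeLE A N) i)
  have hb : LinearIndependent k b :=
    (Module.finBasis k (totalDegreeLE A N)).linearIndependent.map' (Submodule.inclusion hle)
      (Submodule.ker_inclusion _ _ _)
  have hli := linearIndependent_smul hb (ht.1.linearIndependent_prod_pow N)
  have hmem : ∀ p : Fin (Module.finrank k (totalDegreeLE A N)) × (t → Fin (N + 1)),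
      b p.1 • ∏ i : t, (i : R) ^ (p.2 i : ℕ) ∈ MvPolynomial.restrictTotalDegree (Fin n) k
        (N + r * N) := by
    rintro ⟨i, α⟩
    rw [MvPolynomial.mem_restrictTotalDegree, Subalgebra.smul_def, smul_eq_mul]
    refine (MvPolynomial.totalDegree_mul _ _).trans (add_le_add ?_ ?_)
    · exact (mem_totalDegreeLE.mp (Module.finBasis k (totalDegreeLE A N) i).2).2
    · refine (MvPolynomial.totalDegree_finsetProd _ _).trans ?_
      refine (Finset.sum_le_card_nsmul _ _ N fun j _ ↦ ?_).trans (by simp [r])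
      obtain ⟨l, hl⟩ := htX j.2
      rw [← hl]
      refine (MvPolynomial.totalDegree_pow _ _).trans ?_
      rw [MvPolynomial.totalDegree_X, mul_one]
      exact Nat.lt_succ_iff.mp (α j).2
  have hli' := (LinearIndependent.of_comp (Submodule.subtype _)
    (v := fun p ↦ (⟨_, hmem p⟩ : MvPolynomial.restrictTotalDegree (Fin n) k (N + r * N))) hli)
  have h := hli'.fintype_card_le_finrank.trans (MvPolynomial.finrank_restrictTotalDegree_le k n _)
  simp only [Fintype.card_prod, Fintype.card_fin, Fintype.card_pi, Finset.prod_const,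
    Finset.card_univ] at h
  refine Nat.le_of_mul_le_mul_right (c := (N + 1) ^ r) ?_ (by positivity)
  refine h.trans ?_
  calc (N + r * N + 1) ^ n ≤ ((n + 1) * (N + 1)) ^ n := by
        refine Nat.pow_le_pow_left ?_ n
        have : r ≤ n := by lia
        nlinarith
    _ = (n + 1) ^ n * (N + 1) ^ s * (N + 1) ^ r := by
        rw [mul_pow, mul_assoc, ← pow_add, hcard]

theorem Nat.add_one_pow_le_of_div {D : ℕ} (hD : 0 < D) (s N : ℕ) :
    (N + 1) ^ s ≤ D ^ s * (N / D + 1) ^ s := by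
  rw [← mul_pow]
  exact Nat.pow_le_pow_left (Nat.lt_mul_div_succ N hD) s

theorem exists_le_finrank_totalDegreeLE {s : ℕ} (hs : Algebra.trdeg k A = s) :
    ∃ D : ℕ, ∀ N, (N + 1) ^ s ≤ D * Module.finrank k (totalDegreeLE A N) := by
  obtain ⟨y, hy⟩ := exists_algebraicIndependent_of_trdeg_eq hs
  set D := ∑ i, (y i : MvPolynomial (Fin n) k).totalDegree
  -- Exponents up to `N / (D + 1)` keep the monomials in `y` within degree `N`; `D + 1` is positive
  -- even when `s = 0`, where `D = 0`.
  refine ⟨(D + 1) ^ s, fun N ↦ (Nat.add_one_pow_le_of_div D.succ_pos s N).trans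
    (Nat.mul_le_mul_left _ ?_)⟩
  set M := N / (D + 1)
  have hMN : D * M ≤ N :=
    (Nat.mul_le_mul_right M D.le_succ).trans (Nat.mul_div_le N (D + 1))
  have hli := (hy.linearIndependent_prod_pow M).map' A.val.toLinearMap
    (LinearMap.ker_eq_bot.mpr Subtype.val_injective)
  have hmem : ∀ α : Fin s → Fin (M + 1),
      A.val.toLinearMap (∏ i, y i ^ (α i : ℕ)) ∈ totalDegreeLE A N := by
    intro α
    refine mem_totalDegreeLE.mpr ⟨Subtype.prop _, le_trans ?_ hMN⟩
    simp only [AlgHom.toLinearMap_apply, map_prod, map_pow]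
    refine (MvPolynomial.totalDegree_finsetProd _ _).trans ?_
    rw [Finset.sum_mul]
    refine Finset.sum_le_sum fun i _ ↦ (MvPolynomial.totalDegree_pow _ _).trans ?_
    rw [mul_comm]
    exact Nat.mul_le_mul_left _ (Nat.lt_succ_iff.mp (α i).2)
  have hli' := (LinearIndependent.of_comp (Submodule.subtype _)
    (v := fun α ↦ (⟨_, hmem α⟩ : totalDegreeLE A N)) hli)
  simpa using hli'.fintype_card_le_finrank

end Growth

/-- Take for `V` the span of `s` algebraically independent elements: their monomials with exponents
at most `N / (s + 1)` have at most `N` factors. -/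
theorem exists_le_finrank_iSup_pow {k A : Type*} [Field k] [CommRing A] [IsDomain A]
    [Algebra k A] {s : ℕ} (hs : Algebra.trdeg k A = s) :
    ∃ V : Submodule k A, FiniteDimensional k V ∧ ∃ D : ℕ, ∀ N, (N + 1) ^ s ≤
      D * Module.finrank k (⨆ i ∈ Finset.range (N + 1), V ^ i : Submodule k A) := by
  obtain ⟨y, hy⟩ := exists_algebraicIndependent_of_trdeg_eq hs
  have hV : FiniteDimensional k (Submodule.span k (Set.range y)) :=
    FiniteDimensional.span_of_finite k (Set.finite_range y)
  refine ⟨Submodule.span k (Set.range y), hV, (s + 1) ^ s, fun N ↦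
    (Nat.add_one_pow_le_of_div s.succ_pos s N).trans (Nat.mul_le_mul_left _ ?_)⟩
  set V := Submodule.span k (Set.range y)
  set M := N / (s + 1)
  have hMN : s * M ≤ N :=
    (Nat.mul_le_mul_right M s.le_succ).trans (Nat.mul_div_le N (s + 1))
  have hfin (i : ℕ) : FiniteDimensional k (V ^ i : Submodule k A) :=
    Module.Finite.iff_fg.mpr (Submodule.FG.pow (Module.Finite.iff_fg.mp hV) i)
  have hmem : ∀ α : Fin s → Fin (M + 1),
      ∏ i, y i ^ (α i : ℕ) ∈ (⨆ i ∈ Finset.range (N + 1), V ^ i : Submodule k A) := by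
    intro α
    have hle : ∑ i, (α i : ℕ) ≤ N := by
      refine le_trans ?_ hMN
      refine (Finset.sum_le_card_nsmul _ _ M fun i _ ↦ Nat.lt_succ_iff.mp (α i).2).trans (by simp)
    have h : V ^ (∑ i, (α i : ℕ)) ≤ (⨆ i ∈ Finset.range (N + 1), V ^ i : Submodule k A) :=
      le_iSup₂_of_le _ (Finset.mem_range.mpr (Nat.lt_succ_of_le hle)) le_rfl
    refine h ?_
    have hprod (t : Finset (Fin s)) : ∏ i ∈ t, y i ^ (α i : ℕ) ∈ V ^ ∑ i ∈ t, (α i : ℕ) := by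
      induction t using Finset.cons_induction with
      | empty => simp
      | cons i t hi ih =>
        rw [Finset.prod_cons, Finset.sum_cons, pow_add]
        exact Submodule.mul_mem_mul
          (Submodule.pow_mem_pow V (Submodule.subset_span ⟨i, rfl⟩) _) ih
    exact hprod Finset.univ
  have : FiniteDimensional k (⨆ i ∈ Finset.range (N + 1), V ^ i : Submodule k A) :=
    Finset.sup_eq_iSup (Finset.range (N + 1)) (V ^ · : ℕ → Submodule k A) ▸
      Submodule.finiteDimensional_finset_sup _ _
  have hli := (LinearIndependent.of_comp (Submodule.subtype _)
    (v := fun α ↦ (⟨_, hmem α⟩ : (⨆ i ∈ Finset.range (N + 1), V ^ i : Submodule k A)))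
    (hy.linearIndependent_prod_pow M))
  simpa using hli.fintype_card_le_finrank

/-! ### Gelfand–Kirillov dimension -/

theorem tendsto_add_mul_log_div_log (c s : ℝ) :
    Tendsto (fun N : ℕ ↦ (((c + s * Real.log N) / Real.log N : ℝ) : EReal)) atTop
      (𝓝 (s : EReal)) := by
  refine (continuous_coe_real_ereal.tendsto s).comp ?_
  have hlog : Tendsto (fun N : ℕ ↦ Real.log N) atTop atTop :=
    Real.tendsto_log_atTop.comp tendsto_natCast_atTop_atTop
  have h : Tendsto (fun N : ℕ ↦ c / Real.log N + s) atTop (𝓝 (0 + s)) :=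
    (tendsto_const_nhds.div_atTop hlog).add tendsto_const_nhds
  rw [zero_add] at h
  refine h.congr' ?_
  filter_upwards [hlog.eventually_gt_atTop 0] with N hN
  field_simp

theorem limsup_log_div_log_le {u : ℕ → ℕ} {C s : ℕ} (h : ∀ N, u N ≤ C * (N + 1) ^ s) :
    limsup (fun N : ℕ ↦ ((Real.log (u N) / Real.log N : ℝ) : EReal)) atTop ≤ ((s : ℝ) : EReal) := by
  -- The factor `2 ^ s` comes from `N + 1 ≤ 2 * N`.
  rw [← (tendsto_add_mul_log_div_log (Real.log (C * 2 ^ s)) s).limsup_eq]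
  refine limsup_le_limsup ?_
  filter_upwards [eventually_ge_atTop 2] with N hN
  have hN' : (2 : ℝ) ≤ N := by exact_mod_cast hN
  have hlog : 0 < Real.log N := Real.log_pos (by linarith)
  rw [EReal.coe_le_coe_iff]
  refine div_le_div_of_nonneg_right ?_ hlog.le
  rcases Nat.eq_zero_or_pos (u N) with hu | hu
  -- Here `Real.log 0 = 0`, so the bound only needs the constant to be nonnegative.
  · have : 0 ≤ Real.log (C * 2 ^ s) := by exact_mod_cast Real.log_natCast_nonneg (C * 2 ^ s)
    rw [hu, Nat.cast_zero, Real.log_zero]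
    positivity
  · have hC : 0 < C := by
      rcases Nat.eq_zero_or_pos C with h0 | h0
      · have := h N
        simp only [h0, zero_mul] at this
        omega
      · exact h0
    have hC' : (0 : ℝ) < C := by exact_mod_cast hC
    rw [← Real.log_pow, ← Real.log_mul (by positivity) (by positivity)]
    refine Real.log_le_log (by exact_mod_cast hu) ?_
    have h1 : (u N : ℝ) ≤ C * (N + 1) ^ s := by exact_mod_cast h N
    refine h1.trans ?_
    rw [mul_assoc, ← mul_pow]
    gcongr
    linarith

theorem le_limsup_log_div_log {u : ℕ → ℕ} {D s : ℕ} (h : ∀ N, (N + 1) ^ s ≤ D * u N) :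
    ((s : ℝ) : EReal) ≤ limsup (fun N : ℕ ↦ ((Real.log (u N) / Real.log N : ℝ) : EReal)) atTop := by
  rw [← (tendsto_add_mul_log_div_log (-Real.log D) s).limsup_eq]
  refine limsup_le_limsup ?_
  filter_upwards [eventually_ge_atTop 2] with N hN
  have hN' : (2 : ℝ) ≤ N := by exact_mod_cast hN
  have hlog : 0 < Real.log N := Real.log_pos (by linarith)
  rw [EReal.coe_le_coe_iff]
  refine div_le_div_of_nonneg_right ?_ hlog.le
  have hpos : 0 < D * u N := (by positivity : 0 < (N + 1) ^ s).trans_le (h N)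
  have hD : (0 : ℝ) < D := by exact_mod_cast Nat.pos_of_mul_pos_right hpos
  have hu : (0 : ℝ) < u N := by exact_mod_cast Nat.pos_of_mul_pos_left hpos
  rw [neg_add_le_iff_le_add, ← Real.log_pow, ← Real.log_mul hD.ne' hu.ne']
  refine Real.log_le_log (by positivity) ?_
  refine le_trans ?_ (show ((N : ℝ) + 1) ^ s ≤ _ by exact_mod_cast h N)
  gcongr
  linarith

theorem exists_totalDegree_le_of_finiteDimensional {k : Type*} [Field k] {n : ℕ}
    (A : Subalgebra k (MvPolynomial (Fin n) k)) (V : Submodule k A) [FiniteDimensional k V] :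
    ∃ E : ℕ, ∀ v ∈ V, (v : MvPolynomial (Fin n) k).totalDegree ≤ E := by
  obtain ⟨F, hF⟩ := Module.Finite.iff_fg.mp ‹FiniteDimensional k V›
  refine ⟨F.sup fun v ↦ (v : MvPolynomial (Fin n) k).totalDegree, fun v hv ↦ ?_⟩
  have hle : V ≤ (MvPolynomial.restrictTotalDegree (Fin n) k
      (F.sup fun v ↦ (v : MvPolynomial (Fin n) k).totalDegree)).comap A.val.toLinearMap := by
    rw [← hF, Submodule.span_le]
    intro w hw
    exact (MvPolynomial.mem_restrictTotalDegree _ _ _).mpr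
      (Finset.le_sup (f := fun v : A ↦ (v : MvPolynomial (Fin n) k).totalDegree) hw)
  exact (MvPolynomial.mem_restrictTotalDegree _ _ _).mp (hle hv)

theorem totalDegree_le_of_mem_pow {k : Type*} [Field k] {n : ℕ}
    {A : Subalgebra k (MvPolynomial (Fin n) k)} {V : Submodule k A} {E : ℕ}
    (hE : ∀ v ∈ V, (v : MvPolynomial (Fin n) k).totalDegree ≤ E) (i : ℕ) :
    ∀ v ∈ V ^ i, (v : MvPolynomial (Fin n) k).totalDegree ≤ E * i := by
  intro v hv
  induction hv using Submodule.pow_induction_on_left' with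
  | algebraMap r => simp
  | add x y i hx hy ihx ihy =>
    exact (MvPolynomial.totalDegree_add _ _).trans (max_le ihx ihy)
  | mem_mul m hm i x hx ih =>
    rw [Nat.succ_eq_add_one, mul_add, mul_one, add_comm]
    exact (MvPolynomial.totalDegree_mul _ _).trans (add_le_add (hE m hm) ih)

/-- If `V` lies in degrees at most `E`, then `k + V + ⋯ + V ^ N` lies in degrees at most `E * N`, so
the growth of `A` by total degree bounds that of every `V`. -/
theorem gkDim_eq_of_trdeg_eq {k : Type*} [Field k] {n : ℕ}
    (A : Subalgebra k (MvPolynomial (Fin n) k)) {s : ℕ} (hs : Algebra.trdeg k A = s) :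
    gkDim k A = ((s : ℝ) : EReal) := by
  apply le_antisymm
  · refine iSup_le fun ⟨V, hV⟩ ↦ ?_
    obtain ⟨E, hE⟩ := exists_totalDegree_le_of_finiteDimensional A V
    refine limsup_log_div_log_le (C := (n + 1) ^ n * (E + 1) ^ s) fun N ↦ ?_
    have hle : (⨆ i ∈ Finset.range (N + 1), V ^ i : Submodule k A).map A.val.toLinearMap ≤
        totalDegreeLE A (E * N) := by
      rw [Submodule.map_le_iff_le_comap]
      refine iSup₂_le fun i hi v hv ↦ mem_totalDegreeLE.mpr ⟨v.2, ?_⟩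
      exact (totalDegree_le_of_mem_pow hE i v hv).trans
        (Nat.mul_le_mul_left _ (Nat.lt_succ_iff.mp (Finset.mem_range.mp hi)))
    have hinj : Function.Injective A.val.toLinearMap := Subtype.val_injective
    rw [(Submodule.equivMapOfInjective _ hinj _).finrank_eq]
    refine (Submodule.finrank_mono hle).trans ((finrank_totalDegreeLE_le A hs _).trans ?_)
    rw [mul_assoc, ← mul_pow]
    gcongr
    nlinarith
  · obtain ⟨V, hV, D, hD⟩ := exists_le_finrank_iSup_pow hs
    exact (le_limsup_log_div_log hD).trans (le_iSup (fun V : {V : Submodule k A //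
      FiniteDimensional k V} ↦ limsup (fun n : ℕ ↦ ((Real.log (Module.finrank k
        (⨆ i ∈ Finset.range (n + 1), V.1 ^ i : Submodule k A)) / Real.log n : ℝ) : EReal)) atTop)
        ⟨V, hV⟩)

/-! ### Poles of generating functions of lower sets -/

/-- Otherwise pick elements dropped at successive strict decreases. Two of them satisfy `x_i ≤ x_j`
with `i < j`, and `x_j` still lies in the set from which `x_i` was dropped, contradicting that it is
a lower set. -/
theorem exists_forall_ge_eq_of_antitone_isLowerSet {α : Type*} [Preorder α] [WellQuasiOrderedLE α]
    {L : ℕ → Set α} (hL : ∀ j, IsLowerSet (L j)) (hanti : Antitone L) :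
    ∃ J, ∀ j, J ≤ j → L j = L J := by
  by_contra! h
  have h' (J : ℕ) : ∃ j, J ≤ j ∧ ∃ x ∈ L J, x ∉ L j := by
    obtain ⟨j, hj, hne⟩ := h J
    exact ⟨j, hj, Set.not_subset.mp fun hs ↦ hne (Set.Subset.antisymm (hanti hj) hs)⟩
  choose g hg x hx hxg using h'
  have hmono : Monotone fun i ↦ g^[i] 0 :=
    monotone_nat_of_le_succ fun i ↦ by
      rw [Function.iterate_succ_apply']
      exact hg _
  obtain ⟨i, j, hij, hle⟩ := wellQuasiOrdered_le (fun i ↦ x (g^[i] 0))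
  refine hxg (g^[i] 0) (hL _ hle ?_)
  rw [← Function.iterate_succ_apply' g]
  exact hanti (hmono (Nat.succ_le_of_lt hij)) (hx _)

/-- `f` vanishes near `1` from the left, or `(1 - t) ^ d * f t` has a positive limit for some `d`. -/
def HasPositivePole (f : ℝ → ℝ) : Prop :=
  f =ᶠ[𝓝[<] 1] 0 ∨ ∃ d : ℕ, ∃ l : ℝ, 0 < l ∧ Tendsto (fun t ↦ (1 - t) ^ d * f t) (𝓝[<] 1) (𝓝 l)

theorem tendsto_one_sub_pow (e : ℕ) :
    Tendsto (fun t : ℝ ↦ (1 - t) ^ e) (𝓝[<] 1) (𝓝 (if e = 0 then 1 else 0)) := by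
  have h : Tendsto (fun t : ℝ ↦ (1 - t) ^ e) (𝓝 1) (𝓝 ((1 - 1) ^ e)) :=
    Continuous.tendsto (by fun_prop) 1
  rw [sub_self, zero_pow_eq] at h
  exact h.mono_left nhdsWithin_le_nhds

theorem tendsto_one_sub_pow_mul_of_le {f : ℝ → ℝ} {d e : ℕ} {l : ℝ} (hde : d ≤ e)
    (h : Tendsto (fun t ↦ (1 - t) ^ d * f t) (𝓝[<] 1) (𝓝 l)) :
    Tendsto (fun t ↦ (1 - t) ^ e * f t) (𝓝[<] 1) (𝓝 (if e = d then l else 0)) := by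
  have h' := (tendsto_one_sub_pow (e - d)).mul h
  obtain ⟨c, rfl⟩ := Nat.exists_eq_add_of_le hde
  simp only [Nat.add_sub_cancel_left, ite_mul, one_mul, zero_mul, Nat.add_eq_left] at h' ⊢
  refine h'.congr fun t ↦ ?_
  rw [pow_add]
  ring

namespace HasPositivePole

variable {f g : ℝ → ℝ}

theorem congr (hf : HasPositivePole f) (h : f =ᶠ[𝓝[<] 1] g) : HasPositivePole g := by
  rcases hf with hf | ⟨d, l, hl, hf⟩
  · exact Or.inl (h.symm.trans hf)
  · exact Or.inr ⟨d, l, hl, hf.congr' (h.mono fun t ht ↦ by rw [ht])⟩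

theorem zero : HasPositivePole 0 := Or.inl EventuallyEq.rfl

theorem one : HasPositivePole 1 := Or.inr ⟨0, 1, one_pos, by simp⟩

/-- Positive leading coefficients cannot cancel, so the orders combine by maximum. -/
theorem add (hf : HasPositivePole f) (hg : HasPositivePole g) : HasPositivePole (f + g) := by
  rcases hf with hf | ⟨d, l, hl, hf'⟩
  · exact hg.congr (hf.mono fun t ht ↦ by simp [ht])
  rcases hg with hg | ⟨e, l', hl', hg'⟩
  · exact HasPositivePole.congr (Or.inr ⟨d, l, hl, hf'⟩) (hg.mono fun t ht ↦ by simp [ht])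
  refine Or.inr ⟨max d e, (if max d e = d then l else 0) + (if max d e = e then l' else 0), ?_, ?_⟩
  · rcases max_choice d e with h | h <;> simp only [h, if_true] <;> split_ifs <;> linarith
  · refine ((tendsto_one_sub_pow_mul_of_le (le_max_left d e) hf').add
      (tendsto_one_sub_pow_mul_of_le (le_max_right d e) hg')).congr fun t ↦ ?_
    simp only [Pi.add_apply]
    ring

theorem sum {ι : Type*} (s : Finset ι) {f : ι → ℝ → ℝ} (h : ∀ i ∈ s, HasPositivePole (f i)) :
    HasPositivePole (∑ i ∈ s, f i) := by
  induction s using Finset.cons_induction with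
  | empty => simpa using zero
  | cons i s hi ih =>
    rw [Finset.sum_cons]
    exact (h i (Finset.mem_cons_self _ _)).add (ih fun j hj ↦ h j (Finset.mem_cons_of_mem hj))

theorem mul (hf : HasPositivePole f) (hg : HasPositivePole g) : HasPositivePole (f * g) := by
  rcases hf with hf | ⟨d, l, hl, hf⟩
  · exact Or.inl (hf.mono fun t ht ↦ by simp [ht])
  rcases hg with hg | ⟨e, l', hl', hg⟩
  · exact Or.inl (hg.mono fun t ht ↦ by simp [ht])
  refine Or.inr ⟨d + e, l * l', mul_pos hl hl', (hf.mul hg).congr fun t ↦ ?_⟩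
  simp only [Pi.mul_apply, pow_add]
  ring

theorem pow (c : ℕ) : HasPositivePole (fun t ↦ t ^ c) := by
  refine Or.inr ⟨0, 1, one_pos, ?_⟩
  have h : Tendsto (fun t : ℝ ↦ (1 - t) ^ 0 * t ^ c) (𝓝 1) (𝓝 ((1 - 1) ^ 0 * 1 ^ c)) :=
    Continuous.tendsto (by fun_prop) 1
  rw [pow_zero, one_pow, one_mul] at h
  exact h.mono_left nhdsWithin_le_nhds

/-- `(1 - t) / (1 - t^c)` is the inverse of `1 + t + ⋯ + t^(c-1)`, which tends to `c`. -/
theorem inv_one_sub_pow {c : ℕ} (hc : 0 < c) : HasPositivePole (fun t ↦ (1 - t ^ c)⁻¹) := by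
  refine Or.inr ⟨1, (c : ℝ)⁻¹, by positivity, ?_⟩
  have h : Tendsto (fun t : ℝ ↦ ∑ i ∈ Finset.range c, t ^ i) (𝓝 1)
      (𝓝 (∑ i ∈ Finset.range c, 1 ^ i)) := Continuous.tendsto (by fun_prop) 1
  simp only [one_pow, Finset.sum_const, Finset.card_range, nsmul_eq_mul, mul_one] at h
  refine ((h.inv₀ (by positivity)).mono_left nhdsWithin_le_nhds).congr' ?_
  filter_upwards [self_mem_nhdsWithin] with t ht
  have ht' : 1 - t ≠ 0 := (sub_pos.mpr ht).ne'
  rw [← mul_neg_geom_sum t c, mul_inv, pow_one, ← mul_assoc, mul_inv_cancel₀ ht', one_mul]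

end HasPositivePole

theorem summable_pow_sum_mul {m : ℕ} {w : Fin m → ℕ} (hw : ∀ i, 0 < w i) {t : ℝ} (h0 : 0 ≤ t)
    (h1 : t < 1) : Summable fun a : Fin m → ℕ ↦ t ^ ∑ i, w i * a i := by
  induction m with
  | zero => exact Summable.of_finite
  | succ m ih =>
    rw [← (Fin.consEquiv fun _ ↦ ℕ).summable_iff]
    have hg : Summable fun j : ℕ ↦ t ^ (w 0 * j) := by
      simp_rw [pow_mul]
      exact summable_geometric_of_lt_one (by positivity) (pow_lt_one₀ h0 h1 (hw 0).ne')
    refine (hg.mul_of_nonneg (ih fun i ↦ hw i.succ) (fun _ ↦ by positivity)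
      fun _ ↦ by positivity).congr fun p ↦ ?_
    simp [Fin.consEquiv, Fin.sum_univ_succ, pow_add]

/-- Slice by the first coordinate `j`. The slices are decreasing lower sets, constant from some `J`
on, so the series is `∑_{j<J} t^(w₀j) P_j + t^(w₀J) (1 - t^w₀)⁻¹ P_J`, and induction applies to each
`P_j`. Empty slices account for the vanishing alternative in `HasPositivePole`. -/
theorem hasPositivePole_tsum_indicator {m : ℕ} {w : Fin m → ℕ} (hw : ∀ i, 0 < w i)
    {L : Set (Fin m → ℕ)} (hL : IsLowerSet L) :
    HasPositivePole fun t ↦ ∑' a, L.indicator (fun a ↦ t ^ ∑ i, w i * a i) a := by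
  induction m with
  | zero =>
    by_cases h : default ∈ L
    · refine HasPositivePole.one.congr (Eventually.of_forall fun t ↦ ?_)
      dsimp only
      rw [tsum_eq_single default fun b hb ↦ (hb (Subsingleton.elim _ _)).elim,
        Set.indicator_of_mem h]
      simp
    · refine HasPositivePole.zero.congr (Eventually.of_forall fun t ↦ ?_)
      dsimp only
      rw [tsum_eq_single default fun b hb ↦ (hb (Subsingleton.elim _ _)).elim,
        Set.indicator_of_notMem h]
      simp
  | succ m ih =>
    let w' : Fin m → ℕ := fun i ↦ w i.succ
    have hw' : ∀ i, 0 < w' i := fun i ↦ hw i.succ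
    let K : ℕ → Set (Fin m → ℕ) := fun j ↦ {a | (Fin.cons j a : Fin (m + 1) → ℕ) ∈ L}
    have hK (j : ℕ) : IsLowerSet (K j) := fun a b hba ha ↦
      hL (Fin.cons_le_cons.mpr ⟨le_rfl, hba⟩) ha
    have hanti : Antitone K := fun i j hij a ha ↦ hL (Fin.cons_le_cons.mpr ⟨hij, le_rfl⟩) ha
    obtain ⟨J, hJ⟩ := exists_forall_ge_eq_of_antitone_isLowerSet hK hanti
    let P : ℕ → ℝ → ℝ := fun j t ↦ ∑' a, (K j).indicator (fun a ↦ t ^ ∑ i, w' i * a i) a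
    have hP (j : ℕ) : HasPositivePole (P j) := ih hw' (hK j)
    have hsum : HasPositivePole ((∑ j ∈ Finset.range J, (fun t ↦ t ^ (w 0 * j)) * P j) +
        (fun t ↦ t ^ (w 0 * J)) * (fun t ↦ (1 - t ^ w 0)⁻¹) * P J) :=
      (HasPositivePole.sum _ fun j _ ↦ (HasPositivePole.pow _).mul (hP j)).add
        (((HasPositivePole.pow _).mul (HasPositivePole.inv_one_sub_pow (hw 0))).mul (hP J))
    refine hsum.congr ?_
    filter_upwards [Ioo_mem_nhdsLT (show (0 : ℝ) < 1 from one_pos)] with t ht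
    have hsL : Summable fun p : ℕ × (Fin m → ℕ) ↦
        L.indicator (fun a ↦ t ^ ∑ i, w i * a i) (Fin.consEquiv (fun _ ↦ ℕ) p) :=
      (Fin.consEquiv fun _ ↦ ℕ).summable_iff.mpr
        ((summable_pow_sum_mul hw ht.1.le ht.2).indicator L)
    have hinner (j : ℕ) : ∑' a : Fin m → ℕ,
        L.indicator (fun a ↦ t ^ ∑ i, w i * a i) (Fin.consEquiv (fun _ ↦ ℕ) (j, a)) =
        t ^ (w 0 * j) * P j t := by
      rw [← tsum_mul_left]
      refine tsum_congr fun a ↦ ?_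
      by_cases ha : a ∈ K j
      · have ha' : Fin.consEquiv (fun _ ↦ ℕ) (j, a) ∈ L := ha
        rw [Set.indicator_of_mem ha, Set.indicator_of_mem ha']
        simp [Fin.consEquiv, Fin.sum_univ_succ, pow_add, w']
      · have ha' : Fin.consEquiv (fun _ ↦ ℕ) (j, a) ∉ L := ha
        rw [Set.indicator_of_notMem ha, Set.indicator_of_notMem ha', mul_zero]
    have hs : Summable fun j ↦ t ^ (w 0 * j) * P j t :=
      hsL.prod.congr hinner
    rw [← (Fin.consEquiv fun _ ↦ ℕ).tsum_eq, hsL.tsum_prod, tsum_congr hinner,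
      ← hs.sum_add_tsum_nat_add J]
    simp only [Pi.add_apply, Finset.sum_apply, Pi.mul_apply]
    congr 1
    have hterm (j : ℕ) : t ^ (w 0 * (j + J)) * P (j + J) t =
        (t ^ w 0) ^ j * (t ^ (w 0 * J) * P J t) := by
      have : P (j + J) t = P J t := by simp only [P, hJ (j + J) (Nat.le_add_left _ _)]
      rw [this, mul_add, pow_add, pow_mul, mul_assoc]
    rw [tsum_congr hterm, tsum_mul_right,
      tsum_geometric_of_lt_one (by have := ht.1; positivity) (pow_lt_one₀ ht.1.le ht.2 (hw 0).ne')]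
    ring

theorem tsum_indicator_eq_tsum_card_mul {m : ℕ} {w : Fin m → ℕ} (hw : ∀ i, 0 < w i)
    (L : Set (Fin m → ℕ)) {t : ℝ} (h0 : 0 ≤ t) (h1 : t < 1) :
    ∑' a, L.indicator (fun a ↦ t ^ ∑ i, w i * a i) a =
      ∑' j, (Nat.card {a : Fin m → ℕ // a ∈ L ∧ ∑ i, w i * a i = j} : ℝ) * t ^ j := by
  have hs : Summable fun a : L ↦ t ^ ∑ i, w i * a.1 i :=
    (summable_pow_sum_mul hw h0 h1).subtype L
  rw [← tsum_subtype L fun a : Fin m → ℕ ↦ t ^ ∑ i, w i * a i,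
    ← (hs.hasSum.tsum_fiberwise fun a : L ↦ ∑ i, w i * a.1 i).tsum_eq]
  refine tsum_congr fun j ↦ ?_
  have h : ∀ b : (fun a : L ↦ ∑ i, w i * a.1 i) ⁻¹' {j}, t ^ ∑ i, w i * b.1.1 i = t ^ j :=
    fun b ↦ by rw [show ∑ i, w i * b.1.1 i = j from b.2]
  rw [tsum_congr h, tsum_const, nsmul_eq_mul]
  congr 2
  exact Nat.card_congr (Equiv.subtypeSubtypeEquivSubtypeInter (· ∈ L) fun a ↦ ∑ i, w i * a i = j)

/-! ### From growth bounds to the order of the pole -/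

section GrowthSeries

variable {a : ℕ → ℕ} {s : ℕ}

/-- Binomials replace powers because `∑ (N + s).choose s * t ^ N = 1 / (1 - t) ^ (s + 1)`. -/
theorem Nat.add_one_pow_le_factorial_mul_choose (s N : ℕ) :
    (N + 1) ^ s ≤ s.factorial * (N + s).choose s := by
  rw [← Nat.ascFactorial_eq_factorial_mul_choose]
  exact Nat.pow_succ_le_ascFactorial (N + 1) s

theorem summable_sum_range_mul_pow {C : ℕ}
    (hC : ∀ N, ∑ i ∈ Finset.range (N + 1), a i ≤ C * (N + 1) ^ s) {t : ℝ} (h0 : 0 ≤ t)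
    (h1 : t < 1) :
    Summable fun N ↦ ((∑ i ∈ Finset.range (N + 1), a i : ℕ) : ℝ) * t ^ N := by
  have hs := (summable_choose_mul_geometric_of_norm_lt_one s (r := t)
    (by rwa [Real.norm_of_nonneg h0])).mul_left ((C * s.factorial : ℕ) : ℝ)
  refine hs.of_nonneg_of_le (fun N ↦ by positivity) fun N ↦ ?_
  rw [← mul_assoc]
  refine mul_le_mul_of_nonneg_right ?_ (by positivity)
  rw [← Nat.cast_mul, Nat.cast_le]
  refine (hC N).trans ?_
  rw [mul_assoc]
  exact Nat.mul_le_mul_left _ (Nat.add_one_pow_le_factorial_mul_choose s N)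

theorem summable_mul_pow {C : ℕ}
    (hC : ∀ N, ∑ i ∈ Finset.range (N + 1), a i ≤ C * (N + 1) ^ s) {t : ℝ} (h0 : 0 ≤ t)
    (h1 : t < 1) : Summable fun N ↦ (a N : ℝ) * t ^ N := by
  refine (summable_sum_range_mul_pow hC h0 h1).of_nonneg_of_le (fun N ↦ by positivity) fun N ↦ ?_
  refine mul_le_mul_of_nonneg_right ?_ (by positivity)
  exact_mod_cast Finset.single_le_sum (f := a) (fun _ _ ↦ Nat.zero_le _)
    (Finset.self_mem_range_succ N)

/-- Multiplication by `1 - t` takes differences of partial sums; it absorbs one of the `s + 1`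
factors in the binomial comparison. -/
theorem tsum_mul_pow_eq {C : ℕ}
    (hC : ∀ N, ∑ i ∈ Finset.range (N + 1), a i ≤ C * (N + 1) ^ s) {t : ℝ} (h0 : 0 ≤ t)
    (h1 : t < 1) :
    ∑' N, (a N : ℝ) * t ^ N =
      (1 - t) * ∑' N, ((∑ i ∈ Finset.range (N + 1), a i : ℕ) : ℝ) * t ^ N := by
  have hH := summable_sum_range_mul_pow hC h0 h1
  have hH' := hH.mul_left t
  have hshift := (summable_nat_add_iff 1).mpr hH
  have ha := (summable_nat_add_iff 1).mpr (summable_mul_pow hC h0 h1)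
  rw [sub_mul, one_mul, ← tsum_mul_left, hH.tsum_eq_zero_add, add_sub_assoc,
    ← hshift.tsum_sub hH', (summable_mul_pow hC h0 h1).tsum_eq_zero_add]
  simp only [zero_add, Finset.range_one, Finset.sum_singleton]
  congr 1
  refine tsum_congr fun N ↦ ?_
  rw [Finset.sum_range_succ _ (N + 1)]
  push_cast
  ring

theorem one_le_mul_one_sub_pow_mul_tsum {C D : ℕ}
    (hC : ∀ N, ∑ i ∈ Finset.range (N + 1), a i ≤ C * (N + 1) ^ s)
    (hD : ∀ N, (N + 1) ^ s ≤ D * ∑ i ∈ Finset.range (N + 1), a i) {t : ℝ} (h0 : 0 ≤ t)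
    (h1 : t < 1) : 1 ≤ D * ((1 - t) ^ s * ∑' N, (a N : ℝ) * t ^ N) := by
  have hpos : 0 < 1 - t := sub_pos.mpr h1
  have hsum := hasSum_choose_mul_geometric_of_norm_lt_one s (r := t)
    (by rwa [Real.norm_of_nonneg h0])
  have hle : ∑' N, ((N + s).choose s : ℝ) * t ^ N ≤
      ∑' N, (D : ℝ) * (((∑ i ∈ Finset.range (N + 1), a i : ℕ) : ℝ) * t ^ N) := by
    refine hsum.summable.tsum_le_tsum (fun N ↦ ?_)
      ((summable_sum_range_mul_pow hC h0 h1).mul_left _)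
    rw [← mul_assoc]
    refine mul_le_mul_of_nonneg_right ?_ (by positivity)
    exact_mod_cast (Nat.choose_add_le_add_one_pow N s).trans (hD N)
  rw [hsum.tsum_eq, tsum_mul_left, div_le_iff₀ (by positivity)] at hle
  refine hle.trans_eq ?_
  rw [tsum_mul_pow_eq hC h0 h1]
  ring

theorem one_sub_pow_mul_tsum_le {C : ℕ}
    (hC : ∀ N, ∑ i ∈ Finset.range (N + 1), a i ≤ C * (N + 1) ^ s) {t : ℝ} (h0 : 0 ≤ t)
    (h1 : t < 1) : (1 - t) ^ s * ∑' N, (a N : ℝ) * t ^ N ≤ C * s.factorial := by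
  have hpos : 0 < 1 - t := sub_pos.mpr h1
  have hsum := hasSum_choose_mul_geometric_of_norm_lt_one s (r := t)
    (by rwa [Real.norm_of_nonneg h0])
  have hle : ∑' N, ((∑ i ∈ Finset.range (N + 1), a i : ℕ) : ℝ) * t ^ N ≤
      ∑' N, ((C * s.factorial : ℕ) : ℝ) * (((N + s).choose s : ℝ) * t ^ N) := by
    refine (summable_sum_range_mul_pow hC h0 h1).tsum_le_tsum (fun N ↦ ?_)
      (hsum.summable.mul_left _)
    rw [← mul_assoc]
    refine mul_le_mul_of_nonneg_right ?_ (by positivity)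
    rw [← Nat.cast_mul, Nat.cast_le, mul_assoc]
    exact (hC N).trans (Nat.mul_le_mul_left _ (Nat.add_one_pow_le_factorial_mul_choose s N))
  rw [tsum_mul_left, hsum.tsum_eq, mul_one_div, le_div_iff₀ (by positivity)] at hle
  rw [tsum_mul_pow_eq hC h0 h1]
  rw [Nat.cast_mul] at hle
  refine le_trans (le_of_eq ?_) hle
  ring

end GrowthSeries

/-- A function with a positive pole that has the order of growth of `(1 - t)⁻ˢ` has a pole of order
exactly `s`. -/
theorem HasPositivePole.exists_tendsto_of_bounds {f : ℝ → ℝ} (hf : HasPositivePole f) {s : ℕ}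
    {C D : ℝ} (hC : ∀ t ∈ Set.Ioo (0 : ℝ) 1, (1 - t) ^ s * f t ≤ C)
    (hD : ∀ t ∈ Set.Ioo (0 : ℝ) 1, 1 ≤ D * ((1 - t) ^ s * f t)) :
    ∃ l, 0 < l ∧ Tendsto (fun t ↦ (1 - t) ^ s * f t) (𝓝[<] 1) (𝓝 l) := by
  have hI : ∀ᶠ t in 𝓝[<] (1 : ℝ), t ∈ Set.Ioo (0 : ℝ) 1 := Ioo_mem_nhdsLT one_pos
  rcases hf with hf | ⟨d, l, hl, hlim⟩
  · obtain ⟨t, ht, ht'⟩ := (hI.and hf).exists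
    have := hD t ht
    simp only [ht', Pi.zero_apply, mul_zero] at this
    linarith
  -- An order below `s` makes `(1 - t)^s f` tend to `0`, against the lower bound; an order above `s`
  -- makes `l` vanish by the upper bound.
  rcases lt_trichotomy d s with h | rfl | h
  · have h' := (tendsto_one_sub_pow_mul_of_le h.le hlim).const_mul D
    rw [if_neg h.ne', mul_zero] at h'
    have := ge_of_tendsto h' (hI.mono hD)
    linarith
  · exact ⟨l, hl, hlim⟩
  · have hC0 : 0 ≤ |C| := abs_nonneg C
    have h0 : Tendsto (fun t : ℝ ↦ (1 - t) ^ (d - s) * |C|) (𝓝[<] 1) (𝓝 0) := by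
      simpa [(Nat.sub_pos_of_lt h).ne'] using (tendsto_one_sub_pow (d - s)).mul_const |C|
    refine absurd (le_of_tendsto_of_tendsto hlim h0 (hI.mono fun t ht ↦ ?_)) hl.not_ge
    have hd : d = d - s + s := by lia
    dsimp only
    nth_rewrite 1 [hd]
    rw [pow_add, mul_assoc]
    have : 0 ≤ 1 - t := sub_nonneg.mpr ht.2.le
    exact mul_le_mul_of_nonneg_left ((hC t ht).trans (le_abs_self C)) (by positivity)

/-! ### Graded subalgebras and the Hilbert–Serre dimension -/

section Graded

variable {k A : Type*} [Field k] [CommRing A] [Algebra k A] {𝒜 : ℕ → Submodule k A}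

/-- A finite limit at a smaller exponent would force the limit at `s` to be `0`. -/
theorem isLeast_poleExponents {s : ℕ} {l : ℝ} (hl : 0 < l)
    (h : Tendsto (fun t ↦ (1 - t) ^ s * poincareSeries 𝒜 t) (𝓝[<] 1) (𝓝 l)) :
    IsLeast (poleExponents 𝒜) s := by
  refine ⟨⟨l, h⟩, fun e ⟨l', hl'⟩ ↦ ?_⟩
  by_contra! hlt
  have := tendsto_nhds_unique h (tendsto_one_sub_pow_mul_of_le hlt.le hl')
  rw [if_neg hlt.ne'] at this
  exact hl.ne' this

theorem one_le_poincareRadius {s C : ℕ}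
    (hC : ∀ N, ∑ i ∈ Finset.range (N + 1), Module.finrank k (𝒜 i) ≤ C * (N + 1) ^ s) :
    1 ≤ poincareRadius 𝒜 := by
  refine ENNReal.le_of_forall_nnreal_lt fun r hr ↦ ?_
  refine FormalMultilinearSeries.le_radius_of_summable _ ?_
  have hr' : (r : ℝ) < 1 := by exact_mod_cast hr
  refine (summable_mul_pow hC r.2 hr').of_nonneg_of_le (fun N ↦ by positivity) fun N ↦ ?_
  refine mul_le_mul_of_nonneg_right ?_ (by positivity)
  simp

end Graded

section Subalgebra

variable {k : Type*} [Field k] {n : ℕ} (A : Subalgebra k (MvPolynomial (Fin n) k))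

/-- `A` contains the homogeneous components of its elements. -/
def IsGradedSubalgebra : Prop :=
  ∀ f ∈ A, ∀ i, MvPolynomial.homogeneousComponent i f ∈ A

theorem mem_degreePiece {i : ℕ} {f : A} :
    f ∈ degreePiece A i ↔ (f : MvPolynomial (Fin n) k).IsHomogeneous i := Iff.rfl

/-- The homogeneous elements of degree `i` of `A`, as a subspace of the polynomial ring. -/
def homogeneousPart (i : ℕ) : Submodule k (MvPolynomial (Fin n) k) :=
  A.toSubmodule ⊓ MvPolynomial.homogeneousSubmodule (Fin n) k i

theorem mem_homogeneousPart {i : ℕ} {f : MvPolynomial (Fin n) k} :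
    f ∈ homogeneousPart A i ↔ f ∈ A ∧ f.IsHomogeneous i := Iff.rfl

instance (i : ℕ) : FiniteDimensional k (homogeneousPart A i) :=
  Submodule.finiteDimensional_of_le (S₂ := totalDegreeLE A i)
    fun _ hf ↦ mem_totalDegreeLE.mpr ⟨hf.1, hf.2.totalDegree_le⟩

/-- The degree `i` piece of `A` as a subspace of the polynomial ring. -/
def degreePieceEquiv (i : ℕ) : degreePiece A i ≃ₗ[k] homogeneousPart A i where
  toFun f := ⟨f.1, f.1.2, f.2⟩
  invFun f := ⟨⟨f.1, f.2.1⟩, f.2.2⟩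
  map_add' _ _ := rfl
  map_smul' _ _ := rfl

theorem finrank_degreePiece (i : ℕ) :
    Module.finrank k (degreePiece A i) = Module.finrank k (homogeneousPart A i) :=
  (degreePieceEquiv A i).finrank_eq

instance (i : ℕ) : FiniteDimensional k (degreePiece A i) :=
  Module.Finite.equiv (degreePieceEquiv A i).symm

instance : SetLike.GradedMonoid (degreePiece A) where
  one_mem := MvPolynomial.isHomogeneous_one _ _
  mul_mem _ _ _ _ hf hg := hf.mul hg

theorem degreePiece_zero : degreePiece A 0 = 1 := by
  ext f
  rw [mem_degreePiece, ← MvPolynomial.totalDegree_zero_iff_isHomogeneous,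
    MvPolynomial.totalDegree_eq_zero_iff_eq_C, Submodule.mem_one]
  constructor
  · intro h
    exact ⟨_, Subtype.ext h.symm⟩
  · rintro ⟨c, rfl⟩
    change MvPolynomial.C c = _
    simp

variable {A}

theorem IsGradedSubalgebra.isInternal (hA : IsGradedSubalgebra A) :
    DirectSum.IsInternal (degreePiece A) := by
  rw [DirectSum.isInternal_submodule_iff_iSupIndep_and_iSup_eq_top]
  constructor
  · intro i
    rw [Submodule.disjoint_def]
    intro f hf hf'
    have hle : ⨆ j, ⨆ (_ : j ≠ i), degreePiece A j ≤
        LinearMap.ker ((MvPolynomial.homogeneousComponent i).comp A.val.toLinearMap) := by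
      refine iSup₂_le fun j hj g hg ↦ ?_
      rw [LinearMap.mem_ker, LinearMap.comp_apply]
      exact (MvPolynomial.homogeneousComponent_of_mem hg).trans (if_neg hj.symm)
    have h0 := hle hf'
    rw [LinearMap.mem_ker, LinearMap.comp_apply] at h0
    exact Subtype.ext (((MvPolynomial.homogeneousComponent_of_mem hf).trans
      (if_pos rfl)).symm.trans h0)
  · refine eq_top_iff.mpr fun f _ ↦ ?_
    have hf : f = ∑ i ∈ Finset.range ((f : MvPolynomial (Fin n) k).totalDegree + 1),
        (⟨_, hA f f.2 i⟩ : A) := by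
      apply Subtype.ext
      rw [AddSubmonoidClass.coe_finsetSum]
      exact (MvPolynomial.sum_homogeneousComponent _).symm
    rw [hf]
    exact Submodule.sum_mem _ fun i _ ↦ Submodule.mem_iSup_of_mem i
      (MvPolynomial.homogeneousComponent_isHomogeneous i _)

/-- Taking homogeneous components identifies `A_{≤N}` with the product of the `A_i`, `i ≤ N`. The
growth bounds thereby become bounds on partial sums of the Hilbert function. -/
theorem IsGradedSubalgebra.finrank_totalDegreeLE (hA : IsGradedSubalgebra A) (N : ℕ) :
    Module.finrank k (totalDegreeLE A N) =
      ∑ i ∈ Finset.range (N + 1), Module.finrank k (degreePiece A i) := by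
  let Φ : totalDegreeLE A N →ₗ[k] ∀ i : Fin (N + 1), homogeneousPart A i :=
    LinearMap.pi fun i ↦
      LinearMap.codRestrict _
        ((MvPolynomial.homogeneousComponent (i : ℕ)).comp (Submodule.subtype _))
        fun f ↦ ⟨hA f.1 (mem_totalDegreeLE.mp f.2).1 i,
          MvPolynomial.homogeneousComponent_isHomogeneous (i : ℕ) f.1⟩
  have hΦ (f : totalDegreeLE A N) (i : Fin (N + 1)) :
      (Φ f i : MvPolynomial (Fin n) k) = MvPolynomial.homogeneousComponent i f.1 := rfl
  have hinj : Function.Injective Φ := by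
    rw [← LinearMap.ker_eq_bot, LinearMap.ker_eq_bot']
    intro f hf
    apply Subtype.ext
    rw [← MvPolynomial.sum_homogeneousComponent f.1]
    refine Finset.sum_eq_zero fun i hi ↦ ?_
    have hi' : i < N + 1 := (Finset.mem_range.mp hi).trans_le
      (Nat.succ_le_succ (mem_totalDegreeLE.mp f.2).2)
    rw [← hΦ f ⟨i, hi'⟩, hf]
    rfl
  have hsurj : Function.Surjective Φ := by
    intro g
    have hmem : ∑ i, (g i : MvPolynomial (Fin n) k) ∈ totalDegreeLE A N := by
      refine sum_mem fun i _ ↦ mem_totalDegreeLE.mpr ⟨(g i).2.1, ?_⟩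
      exact ((mem_homogeneousPart A).mp (g i).2).2.totalDegree_le.trans (Nat.lt_succ_iff.mp i.2)
    refine ⟨⟨_, hmem⟩, ?_⟩
    funext i
    apply Subtype.ext
    rw [hΦ, map_sum, Finset.sum_eq_single i]
    · exact (MvPolynomial.homogeneousComponent_of_mem (g i).2.2).trans (if_pos rfl)
    · intro j _ hj
      exact (MvPolynomial.homogeneousComponent_of_mem (g j).2.2).trans
        (if_neg fun h ↦ hj (Fin.ext h.symm))
    · simp
  simp_rw [finrank_degreePiece]
  rw [(LinearEquiv.ofBijective Φ ⟨hinj, hsurj⟩).finrank_eq, Module.finrank_pi_fintype,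
    Fin.sum_univ_eq_sum_range fun i ↦ Module.finrank k (homogeneousPart A i)]

/-- A graded subalgebra of a polynomial ring whose Poincaré series has a pole at `1` is a
Hilbert-Serre ring, of dimension its transcendence degree. -/
theorem IsGradedSubalgebra.isHilbertSerre_and_hilbertSerreDim_eq (hA : IsGradedSubalgebra A)
    {s : ℕ} (hs : Algebra.trdeg k A = s) (hP : HasPositivePole (poincareSeries (degreePiece A))) :
    IsHilbertSerre (degreePiece A) ∧ hilbertSerreDim (degreePiece A) = s := by
  have hC (N : ℕ) : ∑ i ∈ Finset.range (N + 1), Module.finrank k (degreePiece A i) ≤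
      (n + 1) ^ n * (N + 1) ^ s := by
    rw [← hA.finrank_totalDegreeLE]
    exact finrank_totalDegreeLE_le A hs N
  obtain ⟨D, hD⟩ := exists_le_finrank_totalDegreeLE A hs
  simp_rw [hA.finrank_totalDegreeLE] at hD
  obtain ⟨l, hl, hlim⟩ := hP.exists_tendsto_of_bounds
    (fun t ht ↦ one_sub_pow_mul_tsum_le hC ht.1.le ht.2)
    (fun t ht ↦ one_le_mul_one_sub_pow_mul_tsum hC hD ht.1.le ht.2)
  have hleast := isLeast_poleExponents hl hlim
  refine ⟨⟨inferInstance, hA.isInternal, FaithfulSMul.algebraMap_injective k A,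
    degreePiece_zero A, inferInstance, one_le_poincareRadius hC, hleast.nonempty⟩,
    hleast.csInf_eq⟩

end Subalgebra

/-! ### Standard monomials in homogeneous generators -/

theorem linearIndependent_of_forall_notMem_span_lt {K V ι Γ : Type*} [Field K] [AddCommGroup V]
    [Module K V] [LinearOrder Γ] {θ : ι → Γ} (hθ : Function.Injective θ) {v : ι → V}
    (hv : ∀ i, v i ∉ Submodule.span K (v '' {j | θ j < θ i})) : LinearIndependent K v := by
  classical
  rw [linearIndependent_iff']
  intro s c hsum
  by_contra! hne
  obtain ⟨i, hi, hci⟩ := hne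
  obtain ⟨j, hj, hmax⟩ := Finset.exists_max_image (s.filter fun i ↦ c i ≠ 0) θ
    ⟨i, Finset.mem_filter.mpr ⟨hi, hci⟩⟩
  obtain ⟨hjs, hcj⟩ := Finset.mem_filter.mp hj
  refine hv j ?_
  rw [← Finset.add_sum_erase s _ hjs, add_eq_zero_iff_eq_neg] at hsum
  have hmem : c j • v j ∈ Submodule.span K (v '' {l | θ l < θ j}) := by
    rw [hsum]
    refine neg_mem (sum_mem fun l hl ↦ ?_)
    obtain ⟨hlj, hls⟩ := Finset.mem_erase.mp hl
    by_cases hcl : c l = 0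
    · simp [hcl]
    · exact Submodule.smul_mem _ _ (Submodule.subset_span ⟨l, lt_of_le_of_ne
        (hmax l (Finset.mem_filter.mpr ⟨hls, hcl⟩)) fun h ↦ hlj (hθ h), rfl⟩)
  exact (Submodule.smul_mem_iff _ hcj).mp hmem

section Standard

variable {k R : Type*} [Field k] [CommRing R] [Algebra k R] {m : ℕ} (f : Fin m → R)

/-- The monomial with exponent `a` in the family `f`. -/
def monomialIn (a : Fin m → ℕ) : R := ∏ i, f i ^ a i

theorem monomialIn_add (a b : Fin m → ℕ) :
    monomialIn f (a + b) = monomialIn f a * monomialIn f b := by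
  simp [monomialIn, pow_add, Finset.prod_mul_distrib]

theorem toSubmodule_adjoin_range_eq_span :
    (Algebra.adjoin k (Set.range f)).toSubmodule = Submodule.span k (Set.range (monomialIn f)) := by
  apply le_antisymm
  · intro p hp
    rw [Subalgebra.mem_toSubmodule, Algebra.adjoin_range_eq_range_aeval] at hp
    obtain ⟨q, rfl⟩ := hp
    rw [AlgHom.toRingHom_eq_coe, RingHom.coe_coe, MvPolynomial.aeval_def, MvPolynomial.eval₂_eq']
    refine sum_mem fun d _ ↦ ?_
    rw [← Algebra.smul_def]
    exact Submodule.smul_mem _ _ (Submodule.subset_span ⟨d, rfl⟩)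
  · rw [Submodule.span_le]
    rintro _ ⟨a, rfl⟩
    have hmem : ∏ i, f i ^ a i ∈ Algebra.adjoin k (Set.range f) :=
      prod_mem fun i _ ↦ pow_mem (Algebra.subset_adjoin (Set.mem_range_self i)) _
    exact hmem

/-- The exponent vector `a` in the well-ordered monoid of the lexicographic order. -/
def lexExponent (a : Fin m → ℕ) : (MonomialOrder.lex (σ := Fin m)).syn :=
  MonomialOrder.lex.toSyn (Finsupp.equivFunOnFinite.symm a)

theorem lexExponent_injective : Function.Injective (lexExponent (m := m)) :=
  MonomialOrder.lex.toSyn.injective.comp Finsupp.equivFunOnFinite.symm.injective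

theorem lexExponent_add (a b : Fin m → ℕ) :
    lexExponent (a + b) = lexExponent a + lexExponent b := by
  rw [lexExponent, lexExponent, lexExponent, ← map_add]
  congr 1
  ext i
  rfl

variable (k)

/-- The exponents of the monomials that are not combinations of smaller ones. -/
def standardExponents : Set (Fin m → ℕ) :=
  {a | monomialIn f a ∉ Submodule.span k (monomialIn f '' {b | lexExponent b < lexExponent a})}

/-- A relation expressing a monomial by smaller ones survives multiplication by any monomial, since
the order is compatible with addition. -/
theorem isLowerSet_standardExponents : IsLowerSet (standardExponents k f) := by
  intro b a hab hb ha
  refine hb ?_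
  obtain ⟨c, rfl⟩ := exists_add_of_le hab
  rw [monomialIn_add, mul_comm]
  have h := Submodule.mem_map_of_mem (f := LinearMap.mulLeft k (monomialIn f c)) ha
  rw [Submodule.map_span, LinearMap.mulLeft_apply] at h
  refine Submodule.span_mono ?_ h
  rintro _ ⟨_, ⟨d, hd, rfl⟩, rfl⟩
  refine ⟨d + c, ?_, ?_⟩
  · rw [Set.mem_ofPred_eq, lexExponent_add, lexExponent_add]
    exact add_lt_add_left hd _
  · rw [LinearMap.mulLeft_apply, monomialIn_add, mul_comm]

theorem linearIndependent_standard :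
    LinearIndependent k fun a : standardExponents k f ↦ monomialIn f a.1 := by
  refine linearIndependent_of_forall_notMem_span_lt
    (lexExponent_injective.comp Subtype.val_injective) fun a ha ↦ a.2 ?_
  refine Submodule.span_mono ?_ ha
  rintro _ ⟨b, hb, rfl⟩
  exact ⟨b.1, hb, rfl⟩

theorem span_standard :
    Submodule.span k (monomialIn f '' standardExponents k f) =
      Submodule.span k (Set.range (monomialIn f)) := by
  refine le_antisymm (Submodule.span_mono (Set.image_subset_range _ _)) ?_
  rw [Submodule.span_le]
  rintro _ ⟨a, rfl⟩
  induction a using (InvImage.wf lexExponent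
    (wellFounded_lt (α := (MonomialOrder.lex (σ := Fin m)).syn))).induction with
  | _ a ih =>
    by_cases ha : a ∈ standardExponents k f
    · exact Submodule.subset_span ⟨a, ha, rfl⟩
    · refine Submodule.span_le.mpr ?_ (not_not.mp ha)
      rintro _ ⟨b, hb, rfl⟩
      exact ih b hb

end Standard

section HomogeneousGenerators

variable {k : Type*} [Field k] {n m : ℕ} {f : Fin m → MvPolynomial (Fin n) k} {w : Fin m → ℕ}

theorem isHomogeneous_monomialIn (hf : ∀ i, (f i).IsHomogeneous (w i)) (a : Fin m → ℕ) :
    (monomialIn f a).IsHomogeneous (∑ i, w i * a i) :=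
  MvPolynomial.IsHomogeneous.prod _ _ _ fun i _ ↦ (hf i).pow (a i)

theorem homogeneousComponent_mem_span (hf : ∀ i, (f i).IsHomogeneous (w i)) (j : ℕ)
    {E : Set (Fin m → ℕ)} {p : MvPolynomial (Fin n) k}
    (hp : p ∈ Submodule.span k (monomialIn f '' E)) :
    MvPolynomial.homogeneousComponent j p ∈
      Submodule.span k (monomialIn f '' {a | a ∈ E ∧ ∑ i, w i * a i = j}) := by
  have h := Submodule.mem_map_of_mem (f := MvPolynomial.homogeneousComponent j) hp
  rw [Submodule.map_span] at h
  refine Submodule.span_le.mpr ?_ h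
  rintro _ ⟨_, ⟨a, ha, rfl⟩, rfl⟩
  rw [MvPolynomial.homogeneousComponent_of_mem (isHomogeneous_monomialIn hf a)]
  split_ifs with hj
  · exact Submodule.subset_span ⟨a, ⟨ha, hj.symm⟩, rfl⟩
  · exact zero_mem _

theorem isGradedSubalgebra_adjoin_range (hf : ∀ i, (f i).IsHomogeneous (w i)) :
    IsGradedSubalgebra (Algebra.adjoin k (Set.range f)) := by
  intro p hp j
  rw [← Subalgebra.mem_toSubmodule, toSubmodule_adjoin_range_eq_span] at hp ⊢
  rw [← Set.image_univ] at hp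
  exact Submodule.span_mono (Set.image_subset_range _ _) (homogeneousComponent_mem_span hf j hp)

/-- Standard monomials are a basis of the algebra, and each is homogeneous of its weight, so those
of weight `j` are a basis of the degree `j` part. -/
theorem finrank_homogeneousPart_adjoin_range (hf : ∀ i, (f i).IsHomogeneous (w i)) (j : ℕ) :
    Module.finrank k (homogeneousPart (Algebra.adjoin k (Set.range f)) j) =
      Nat.card {a : Fin m → ℕ // a ∈ standardExponents k f ∧ ∑ i, w i * a i = j} := by
  let E : Set (Fin m → ℕ) := {a | a ∈ standardExponents k f ∧ ∑ i, w i * a i = j}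
  have hspan : homogeneousPart (Algebra.adjoin k (Set.range f)) j =
      Submodule.span k (Set.range fun a : E ↦ monomialIn f a.1) := by
    have hrange : Set.range (fun a : E ↦ monomialIn f a.1) = monomialIn f '' E := by
      rw [Set.image_eq_range]
    rw [hrange]
    apply le_antisymm
    · intro p hp
      have hp1 : p ∈ (Algebra.adjoin k (Set.range f)).toSubmodule := hp.1
      rw [toSubmodule_adjoin_range_eq_span, ← span_standard] at hp1
      have h := homogeneousComponent_mem_span hf j hp1
      rwa [MvPolynomial.homogeneousComponent_of_mem hp.2, if_pos rfl] at h
    · rw [Submodule.span_le]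
      rintro _ ⟨a, ha, rfl⟩
      refine (mem_homogeneousPart _).mpr ⟨?_, ?_⟩
      · rw [← Subalgebra.mem_toSubmodule, toSubmodule_adjoin_range_eq_span]
        exact Submodule.subset_span ⟨a, rfl⟩
      · rw [← ha.2]
        exact isHomogeneous_monomialIn hf a
  have hli : LinearIndependent k fun a : E ↦ monomialIn f a.1 :=
    (linearIndependent_standard k f).comp (fun a : E ↦ (⟨a.1, a.2.1⟩ : standardExponents k f))
      fun a b h ↦ Subtype.ext (show a.1 = b.1 from congrArg (fun x : standardExponents k f ↦ x.1) h)
  rw [hspan, Module.finrank_eq_nat_card_basis (Module.Basis.span hli)]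
  rfl

theorem hasPositivePole_poincareSeries_adjoin_range (hf : ∀ i, (f i).IsHomogeneous (w i))
    (hw : ∀ i, 0 < w i) :
    HasPositivePole (poincareSeries (degreePiece (Algebra.adjoin k (Set.range f)))) := by
  refine (hasPositivePole_tsum_indicator hw (isLowerSet_standardExponents k f)).congr ?_
  filter_upwards [Ioo_mem_nhdsLT (show (0 : ℝ) < 1 from one_pos)] with t ht
  rw [tsum_indicator_eq_tsum_card_mul hw _ ht.1.le ht.2, poincareSeries]
  simp_rw [finrank_degreePiece, finrank_homogeneousPart_adjoin_range hf]

end HomogeneousGenerators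

/-- Constant generators, zero included, are discarded; positive weights make the sums over exponent
vectors converge. -/
theorem IsFGHomogeneous.exists_generators {k : Type*} [Field k] {n : ℕ}
    {S : Subalgebra k (MvPolynomial (Fin n) k)} (hS : IsFGHomogeneous S) :
    ∃ (m : ℕ) (f : Fin m → MvPolynomial (Fin n) k) (w : Fin m → ℕ),
      (∀ i, (f i).IsHomogeneous (w i)) ∧ (∀ i, 0 < w i) ∧ S = Algebra.adjoin k (Set.range f) := by
  classical
  obtain ⟨F, hF, rfl⟩ := hS
  let G := F.filter fun p ↦ p.totalDegree ≠ 0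
  have hG (p : G) : p.1 ∈ F ∧ p.1.totalDegree ≠ 0 := Finset.mem_filter.mp p.2
  refine ⟨G.card, fun i ↦ G.equivFin.symm i, fun i ↦ (G.equivFin.symm i).1.totalDegree,
    fun i ↦ ?_, fun i ↦ Nat.pos_of_ne_zero (hG _).2, ?_⟩
  · obtain ⟨e, he⟩ := hF _ (hG (G.equivFin.symm i)).1
    dsimp only
    rwa [he.totalDegree fun h0 ↦ (hG (G.equivFin.symm i)).2 (by rw [h0]; simp)]
  · have hrange : Set.range (fun i ↦ (G.equivFin.symm i : MvPolynomial (Fin n) k)) = G := by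
      ext p
      constructor
      · rintro ⟨i, rfl⟩
        exact (G.equivFin.symm i).2
      · intro hp
        exact ⟨G.equivFin ⟨p, hp⟩, by simp⟩
    rw [hrange]
    apply le_antisymm
    · refine Algebra.adjoin_le fun p hp ↦ ?_
      by_cases h : p.totalDegree = 0
      · rw [MvPolynomial.totalDegree_eq_zero_iff_eq_C.mp h]
        exact Subalgebra.algebraMap_mem _ _
      · exact Algebra.subset_adjoin (Finset.mem_coe.mpr (Finset.mem_filter.mpr ⟨hp, h⟩))
    · exact Algebra.adjoin_mono (Finset.coe_subset.mpr (Finset.filter_subset _ _))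

/-! ### The initial algebra and its Hilbert function -/

section Degrees

variable {k : Type*} [Field k] {n : ℕ} (m : MonomialOrder (Fin n))

/-- The degrees of the nonzero elements of a set of polynomials. -/
def degreeSet (V : Set (MvPolynomial (Fin n) k)) : Set (Fin n →₀ ℕ) :=
  {γ | ∃ f ∈ V, f ≠ 0 ∧ m.degree f = γ}

/-- One element of `V` per leading exponent gives a basis: distinct leading exponents give
independence, and cancelling leading terms terminates because the order is well-founded. -/
theorem finrank_eq_card_degreeSet (V : Submodule k (MvPolynomial (Fin n) k)) :
    Module.finrank k V = Nat.card (degreeSet m (V : Set (MvPolynomial (Fin n) k))) := by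
  choose v hvV hv0 hv using fun γ : degreeSet m (V : Set (MvPolynomial (Fin n) k)) ↦ γ.2
  have hli : LinearIndependent k v := by
    refine linearIndependent_of_forall_notMem_span_lt (θ := fun γ ↦ m.toSyn γ.1)
      (fun γ δ h ↦ Subtype.ext (m.toSyn.injective h)) fun γ hγ ↦ ?_
    have hle : Submodule.span k (v '' {δ | m.toSyn δ.1 < m.toSyn γ.1}) ≤
        LinearMap.ker (MvPolynomial.lcoeff k γ.1) := by
      rw [Submodule.span_le]
      rintro _ ⟨δ, hδ, rfl⟩
      exact m.coeff_eq_zero_of_lt (by rw [hv δ]; exact hδ)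
    have h0 : (v γ).coeff γ.1 = 0 := hle hγ
    rw [← hv γ] at h0
    exact hv0 γ (m.coeff_degree_eq_zero_iff.mp h0)
  have hspan : Submodule.span k (Set.range v) = V := by
    apply le_antisymm
    · rw [Submodule.span_le]
      rintro _ ⟨γ, rfl⟩
      exact hvV γ
    · intro p hp
      induction p using (InvImage.wf (fun p : MvPolynomial (Fin n) k ↦ m.toSyn (m.degree p))
        wellFounded_lt).induction with
      | _ p ih =>
        by_cases hp0 : p = 0
        · rw [hp0]
          exact zero_mem _
        let γ : degreeSet m (V : Set (MvPolynomial (Fin n) k)) := ⟨m.degree p, p, hp, hp0, rfl⟩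
        have hc : (v γ).coeff (m.degree p) ≠ 0 := by
          have := m.coeff_degree_ne_zero_iff.mpr (hv0 γ)
          rwa [hv γ] at this
        set c := p.coeff (m.degree p) / (v γ).coeff (m.degree p)
        have hmem : c • v γ ∈ Submodule.span k (Set.range v) :=
          Submodule.smul_mem _ _ (Submodule.subset_span ⟨γ, rfl⟩)
        have hq : p - c • v γ ∈ Submodule.span k (Set.range v) := by
          by_cases hq0 : p - c • v γ = 0
          · rw [hq0]
            exact zero_mem _
          refine ih _ ?_ (V.sub_mem hp (V.smul_mem c (hvV γ)))
          refine lt_of_le_of_ne ?_ fun heq ↦ ?_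
          · refine m.degree_sub_le.trans (max_le le_rfl (m.degree_smul_le.trans_eq ?_))
            rw [hv γ]
          · refine m.coeff_degree_ne_zero_iff.mpr hq0 ?_
            rw [m.toSyn.injective heq, MvPolynomial.coeff_sub, MvPolynomial.coeff_smul,
              smul_eq_mul, div_mul_cancel₀ _ hc, sub_self]
        have := add_mem hq hmem
        rwa [sub_add_cancel] at this
  rw [← Module.finrank_eq_nat_card_basis (Module.Basis.span hli), hspan]

theorem exists_mem_degreeSet_of_ne_zero {V : Set (MvPolynomial (Fin n) k)}
    {f : MvPolynomial (Fin n) k} (hf : f ∈ V) (h0 : f ≠ 0) : m.degree f ∈ degreeSet m V :=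
  ⟨f, hf, h0, rfl⟩

variable {m} {S : Subalgebra k (MvPolynomial (Fin n) k)}

theorem monomial_mem_initialAlgebra {γ : Fin n →₀ ℕ}
    (hγ : γ ∈ degreeSet m (S : Set (MvPolynomial (Fin n) k))) (c : k) :
    MvPolynomial.monomial γ c ∈ initialAlgebra m S := by
  obtain ⟨f, hf, h0, rfl⟩ := hγ
  have hlc : m.leadingCoeff f ≠ 0 := m.leadingCoeff_ne_zero_iff.mpr h0
  have h : MvPolynomial.monomial (m.degree f) c = (c / m.leadingCoeff f) • m.leadingTerm f := by
    rw [MonomialOrder.leadingTerm, MvPolynomial.smul_monomial, smul_eq_mul,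
      div_mul_cancel₀ _ hlc]
  rw [h]
  exact Subalgebra.smul_mem _ (Algebra.subset_adjoin (Set.mem_image_of_mem _ hf)) _

/-- Leading exponents of nonzero elements of `S` are closed under addition, as `R` is a domain, so
the monomials with these exponents already span the initial algebra. -/
theorem mem_initialAlgebra_iff {p : MvPolynomial (Fin n) k} :
    p ∈ initialAlgebra m S ↔
      ∀ γ ∈ p.support, γ ∈ degreeSet m (S : Set (MvPolynomial (Fin n) k)) := by
  classical
  constructor
  · intro hp
    induction hp using Algebra.adjoin_induction with
    | mem p hp =>
      obtain ⟨f, hf, rfl⟩ := hp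
      intro γ hγ
      by_cases h0 : f = 0
      · simp [h0] at hγ
      · rw [m.support_leadingTerm' h0, Finset.mem_singleton] at hγ
        exact hγ ▸ exists_mem_degreeSet_of_ne_zero m hf h0
    | algebraMap c =>
      intro γ hγ
      have h0 : γ = 0 := Finset.mem_singleton.mp (MvPolynomial.support_monomial_subset hγ)
      rw [h0, ← m.degree_one (R := k)]
      exact exists_mem_degreeSet_of_ne_zero m (one_mem S) one_ne_zero
    | add p q _ _ hp hq =>
      intro γ hγ
      rcases Finset.mem_union.mp (MvPolynomial.support_add hγ) with h | h
      exacts [hp γ h, hq γ h]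
    | mul p q _ _ hp hq =>
      intro γ hγ
      obtain ⟨α, hα, β, hβ, rfl⟩ := Finset.mem_add.mp (MvPolynomial.support_mul p q hγ)
      obtain ⟨f, hf, hf0, rfl⟩ := hp α hα
      obtain ⟨g, hg, hg0, rfl⟩ := hq β hβ
      rw [← m.degree_mul hf0 hg0]
      exact exists_mem_degreeSet_of_ne_zero m (mul_mem hf hg) (mul_ne_zero hf0 hg0)
  · intro h
    rw [p.as_sum]
    exact sum_mem fun γ hγ ↦ monomial_mem_initialAlgebra (h γ hγ) _

theorem isGradedSubalgebra_initialAlgebra : IsGradedSubalgebra (initialAlgebra m S) := by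
  intro p hp i
  rw [mem_initialAlgebra_iff] at hp ⊢
  intro γ hγ
  rw [MvPolynomial.support_homogeneousComponent] at hγ
  exact hp γ (Finset.mem_filter.mp hγ).1

/-- The order need not refine total degree, so `f ∈ S` with leading exponent of degree `i` may have
terms in other degrees. Its component of degree `i` stays in `S` and keeps the leading exponent. -/
theorem degreeSet_homogeneousPart_initialAlgebra (hS : IsGradedSubalgebra S) (i : ℕ) :
    degreeSet m (homogeneousPart (initialAlgebra m S) i : Set (MvPolynomial (Fin n) k)) =
      degreeSet m (homogeneousPart S i : Set (MvPolynomial (Fin n) k)) := by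
  ext γ
  constructor
  · rintro ⟨g, ⟨hg, hgi⟩, hg0, rfl⟩
    have hsupp := m.degree_mem_support hg0
    obtain ⟨f, hf, hf0, hfg⟩ := mem_initialAlgebra_iff.mp hg _ hsupp
    have hdeg : (m.degree g).degree = i := by
      by_contra h
      exact MvPolynomial.mem_support_iff.mp hsupp (hgi.coeff_eq_zero h)
    have hcoeff : (MvPolynomial.homogeneousComponent i f).coeff (m.degree g) ≠ 0 := by
      rw [MvPolynomial.coeff_homogeneousComponent, if_pos hdeg, ← hfg]
      exact m.coeff_degree_ne_zero_iff.mpr hf0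
    refine ⟨MvPolynomial.homogeneousComponent i f,
      ⟨hS f hf i, MvPolynomial.homogeneousComponent_isHomogeneous i f⟩, fun h ↦ ?_, ?_⟩
    · rw [h] at hcoeff
      exact hcoeff (MvPolynomial.coeff_zero _)
    · apply m.toSyn.injective
      apply le_antisymm
      · rw [← hfg]
        refine m.degree_le_degree_of_support_subset ?_
        rw [MvPolynomial.support_homogeneousComponent]
        exact Finset.filter_subset _ _
      · exact m.le_degree (MvPolynomial.mem_support_iff.mpr hcoeff)
  · rintro ⟨f, ⟨hf, hfi⟩, hf0, rfl⟩
    have hdeg : (m.degree f).degree = i := by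
      by_contra h
      exact MvPolynomial.mem_support_iff.mp (m.degree_mem_support hf0) (hfi.coeff_eq_zero h)
    refine ⟨m.leadingTerm f, ⟨Algebra.subset_adjoin ⟨f, hf, rfl⟩, ?_⟩, ?_, m.degree_leadingTerm f⟩
    · exact MvPolynomial.isHomogeneous_monomial _ hdeg
    · rwa [Ne, m.leadingTerm_eq_zero_iff]

theorem poincareSeries_initialAlgebra (hS : IsGradedSubalgebra S) :
    poincareSeries (degreePiece (initialAlgebra m S)) = poincareSeries (degreePiece S) := by
  funext t
  refine tsum_congr fun i ↦ ?_
  rw [finrank_degreePiece, finrank_degreePiece, finrank_eq_card_degreeSet m,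
    finrank_eq_card_degreeSet m, degreeSet_homogeneousPart_initialAlgebra hS]

end Degrees

/-! ### Krull dimension of the initial algebra -/

/-- Finitely many elements of a set of exponents generate, up to multiples of their sum, all of its
elements. -/
theorem exists_finset_forall_exists_add_nsmul_eq {n : ℕ} (G : Set (Fin n →₀ ℕ)) :
    ∃ T : Finset (Fin n →₀ ℕ), (T : Set (Fin n →₀ ℕ)) ⊆ G ∧
      ∀ γ ∈ G, ∃ M : ℕ, ∃ e : (Fin n →₀ ℕ) → ℕ, γ + M • ∑ t ∈ T, t = ∑ t ∈ T, e t • t := by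
  classical
  let φ : (Fin n →₀ ℕ) → (Fin n → ℤ) := fun γ i ↦ γ i
  have hφ : Function.Injective φ := fun a b h ↦
    Finsupp.ext fun i ↦ Nat.cast_injective (congrFun h i)
  -- The monoid generated by `G` may fail to be finitely generated, but the subgroup of `ℤ^n` it
  -- generates is, and by elements of `G`.
  obtain ⟨U, hU, hspan⟩ := Submodule.fg_span_iff_fg_span_finset_subset (φ '' G) |>.mp
    (IsNoetherian.noetherian (Submodule.span ℤ (φ '' G)))
  obtain ⟨T, hT, rfl⟩ := Finset.subset_set_image_iff.mp hU
  refine ⟨T, hT, fun γ hγ ↦ ?_⟩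
  have hmem : φ γ ∈ Submodule.span ℤ (T.image φ : Set (Fin n → ℤ)) :=
    hspan ▸ Submodule.subset_span ⟨γ, hγ, rfl⟩
  obtain ⟨a, -, ha⟩ := Submodule.mem_span_finset.mp hmem
  rw [Finset.sum_image hφ.injOn] at ha
  -- Adding `M = ∑ |a_t|` to every integer coefficient makes all of them nonnegative.
  refine ⟨∑ t ∈ T, (a (φ t)).natAbs, fun t ↦
    (a (φ t) + (∑ t ∈ T, (a (φ t)).natAbs : ℕ)).toNat, ?_⟩
  set M := ∑ t ∈ T, (a (φ t)).natAbs
  have hnonneg : ∀ t ∈ T, 0 ≤ a (φ t) + (M : ℤ) := by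
    intro t ht
    have : (a (φ t)).natAbs ≤ M :=
      Finset.single_le_sum (f := fun t ↦ (a (φ t)).natAbs) (fun _ _ ↦ Nat.zero_le _) ht
    lia
  apply hφ
  funext i
  have hi := congrFun ha i
  simp only [φ, Finset.sum_apply, Pi.smul_apply, smul_eq_mul] at hi
  simp only [φ, Finsupp.add_apply, Finsupp.smul_apply, Finsupp.finsetSum_apply, smul_eq_mul,
    Nat.cast_add, Nat.cast_mul, Nat.cast_sum]
  rw [← hi, Finset.mul_sum, ← Finset.sum_add_distrib]
  refine Finset.sum_congr rfl fun t ht ↦ ?_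
  rw [Int.toNat_of_nonneg (hnonneg t ht)]
  ring

section Krull

variable {k : Type*} [Field k] {n : ℕ} {m : MonomialOrder (Fin n)}
  {S : Subalgebra k (MvPolynomial (Fin n) k)}

/-- With `f` the product of the monomials `x^t`, `t ∈ T`, each monomial of the initial algebra
enters `B = k[x^t | t ∈ T]` after multiplication by a power of `f`; a polynomial has finitely many
terms, so one power serves them all. -/
theorem exists_fg_subalgebra_initialAlgebra :
    ∃ B ≤ initialAlgebra m S, B.FG ∧ ∃ f ∈ B, f ≠ 0 ∧
      ∀ a ∈ initialAlgebra m S, ∃ M : ℕ, a * f ^ M ∈ B := by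
  obtain ⟨T, hTG, hT⟩ :=
    exists_finset_forall_exists_add_nsmul_eq (degreeSet m (S : Set (MvPolynomial (Fin n) k)))
  let x : (Fin n →₀ ℕ) → MvPolynomial (Fin n) k := fun t ↦ MvPolynomial.monomial t 1
  set B := Algebra.adjoin k (x '' T)
  have hxB : ∀ t ∈ T, x t ∈ B := fun t ht ↦ Algebra.subset_adjoin ⟨t, ht, rfl⟩
  set f := x (∑ t ∈ T, t)
  have hfB : f ∈ B := by
    have : f = ∏ t ∈ T, x t := MvPolynomial.monomial_sum_one T fun t ↦ t
    rw [this]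
    exact prod_mem hxB
  have hγ : ∀ γ ∈ degreeSet m (S : Set (MvPolynomial (Fin n) k)), ∃ M, x γ * f ^ M ∈ B := by
    intro γ hγ
    obtain ⟨M, e, he⟩ := hT γ hγ
    refine ⟨M, ?_⟩
    have h : x γ * f ^ M = ∏ t ∈ T, x t ^ e t := by
      simp only [x, f, MvPolynomial.monomial_pow, MvPolynomial.monomial_mul, one_pow, mul_one, he]
      exact MvPolynomial.monomial_sum_one T fun t ↦ e t • t
    rw [h]
    exact prod_mem fun t ht ↦ pow_mem (hxB t ht) _
  refine ⟨B, Algebra.adjoin_le ?_, Subalgebra.fg_def.mpr ⟨_, T.finite_toSet.image x, rfl⟩, f, hfB,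
    by simp [f, x], fun a ha ↦ ?_⟩
  · rintro _ ⟨t, ht, rfl⟩
    exact monomial_mem_initialAlgebra (hTG ht) 1
  · rw [mem_initialAlgebra_iff] at ha
    choose! M hM using hγ
    refine ⟨a.support.sup M, ?_⟩
    nth_rewrite 1 [a.as_sum]
    rw [Finset.sum_mul]
    refine sum_mem fun γ hγ ↦ ?_
    obtain ⟨c, hc⟩ := Nat.exists_eq_add_of_le (Finset.le_sup (f := M) hγ)
    have h : MvPolynomial.monomial γ (a.coeff γ) = a.coeff γ • x γ := by
      simp [x, MvPolynomial.smul_monomial]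
    rw [h, hc, pow_add, smul_mul_assoc, ← mul_assoc]
    exact B.smul_mem (mul_mem (hM γ (ha γ hγ)) (pow_mem hfB c)) _

theorem ringKrullDim_initialAlgebra {d : ℕ} (hd : Algebra.trdeg k (initialAlgebra m S) = d) :
    ringKrullDim (initialAlgebra m S) = d := by
  obtain ⟨B, hB, hfg, f, hfB, hf0, h⟩ := exists_fg_subalgebra_initialAlgebra (m := m) (S := S)
  refine ringKrullDim_eq_of_trdeg_eq hd (B.comap (initialAlgebra m S).val) ?_ ⟨f, hB hfB⟩
    (fun h ↦ hf0 (congrArg Subtype.val h)) fun a ↦ h a a.2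
  refine Subalgebra.fg_of_fg_map _ (initialAlgebra m S).val Subtype.val_injective ?_
  have hmap : (B.comap (initialAlgebra m S).val).map (initialAlgebra m S).val = B := by
    ext p
    constructor
    · rintro ⟨q, hq, rfl⟩
      exact hq
    · exact fun hp ↦ ⟨⟨p, hB hp⟩, hp, rfl⟩
  rwa [hmap]

end Krull

end

/-! ### Conclusion -/

theorem corollary5p5 {k : Type*} [Field k] {n : ℕ} (m : MonomialOrder (Fin n))
    (S : Subalgebra k (MvPolynomial (Fin n) k)) (hS : IsFGHomogeneous S) :
    IsHilbertSerre (degreePiece S) ∧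
    IsHilbertSerre (degreePiece (initialAlgebra m S)) ∧
    ∃ d : ℕ,
      (ringKrullDim S = (d : WithBot ℕ∞) ∧
        Algebra.trdeg k S = (d : Cardinal) ∧
        gkDim k S = ((d : ℝ) : EReal) ∧
        hilbertSerreDim (degreePiece S) = d) ∧
      (ringKrullDim (initialAlgebra m S) = (d : WithBot ℕ∞) ∧
        Algebra.trdeg k (initialAlgebra m S) = (d : Cardinal) ∧
        gkDim k (initialAlgebra m S) = ((d : ℝ) : EReal) ∧
        hilbertSerreDim (degreePiece (initialAlgebra m S)) = d) := by
  obtain ⟨r, f, w, hf, hw, rfl⟩ := hS.exists_generators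
  set S := Algebra.adjoin k (Set.range f)
  have hgr : IsGradedSubalgebra S := isGradedSubalgebra_adjoin_range hf
  have hpole : HasPositivePole (poincareSeries (degreePiece S)) :=
    hasPositivePole_poincareSeries_adjoin_range hf hw
  have hP := poincareSeries_initialAlgebra (m := m) hgr
  have : Algebra.FiniteType k S := (Subalgebra.fg_iff_finiteType S).mp
    (Subalgebra.fg_def.mpr ⟨_, Set.finite_range f, rfl⟩)
  obtain ⟨d, hd, hdim⟩ := exists_trdeg_eq_ringKrullDim_of_finiteType k S
  obtain ⟨e, he⟩ := exists_trdeg_eq (initialAlgebra m S)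
  obtain ⟨hHS, hHSd⟩ := hgr.isHilbertSerre_and_hilbertSerreDim_eq hd hpole
  obtain ⟨hHS', hHSd'⟩ := (isGradedSubalgebra_initialAlgebra (m := m)
    (S := S)).isHilbertSerre_and_hilbertSerreDim_eq he (hP ▸ hpole)
  -- The transcendence degrees agree because each is a Hilbert–Serre dimension, which depends only
  -- on the common Poincaré series.
  have hde : e = d := by
    rw [← hHSd, ← hHSd']
    simp only [hilbertSerreDim, poleExponents, hP]
  subst hde
  exact ⟨hHS, hHS', e, ⟨hdim, hd, gkDim_eq_of_trdeg_eq S hd, hHSd⟩,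
    ringKrullDim_initialAlgebra he, he, gkDim_eq_of_trdeg_eq _ he, hHSd'⟩
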